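/- **Proposition C.1 (nodal density and spin operators).** Let $L>0$ and $\tilde a>0$ be such that $L/\tilde a$ is a positive integer. Write vectors of $\mathbb R^2$ as ${\bf k}=k_+{\bf e}_++k_-{\bf e}_-$ and for $s=\pm$ put $$\Lambda_s^*=\Bigl\{{\bf k}: k_\pm\in\tfrac{2\pi}{L}(\mathbb Z+\tfrac12),\ -\tfrac{\pi}{\tilde a}\le k_{-s}<\tfrac{\pi}{\tilde a}\Bigr\},\qquad \tilde\Lambda^*=\bigl\{{\bf p}: p_\pm\in\tfrac{2\pi}{L}\mathbb Z\bigr\}.$$ Let $\mathcal F$ be the fermion Fock space over the Dirac vacuum $\Omega$, $\|\Omega\|=1$, with fermion operators $\hat\psi_{r,s,\alpha}({\bf k})$ ($r,s=\pm$, spin $\alpha=\pm$, ${\bf k}\in\Lambda_s^*$) satisfying $\{\hat\psi_{r,s,\alpha}({\bf k}),\hat\psi^\dagger_{r',s',\alpha'}({\bf k}')\}=(L/2\pi)^2\delta_{r,r'}\delta_{s,s'}\delta_{\alpha,\alpha'}\delta_{{\bf k},{\bf k}'}$, $\{\hat\psi,\hat\psi\}=0$, and $\hat\psi_{r,s,\alpha}({\bf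 k})\Omega=0$ if $rk_s>0$, $\hat\psi^\dagger_{r,s,\alpha}({\bf k})\Omega=0$ if $rk_s<0$. Let $\mathcal D\subset\mathcal F$ be the linear span of the occupation-number basis vectors with finitely many particle and hole excitations of $\Omega$. Write $:\!O\!:\,=O-\langle\Omega,O\Omega\rangle$ for fermion bilinears $O$, let $\sigma^0=1$ and let $\sigma^1,\sigma^2,\sigma^3$ be the Pauli matrices. For $r,s=\pm$, $\mu=0,1,2,3$ and ${\bf p}\in\tilde\Lambda^*$ consider $$\hat J^\mu_{r,s}({\bf p})=\sum_{\alpha,\beta}\ \sum_{{\bf k}_1,{\bf k}_2\in\Lambda_s^*}\ \sum_{n\in\mathbb Z}\Bigl(\frac{2\pi}{L}\Bigr)^2:\!\hat\psi^\dagger_{r,s,\alpha}({\bf k}_1)\,\sigma^\mu_{\alpha,\beta}\,\hat\psi_{r,s,\beta}({\bf k}_2)\!:\ \delta_{{\bf k}_1+{\bf p},\,{\bf k}_2+2\pi n{\bf e}_{-s}/\tilde a},$$ and $\hat J_{r,s}=\hat J^0_{r,s}$, $\hat S^i_{r,s}=\tfrac12\hat J^i_{r,s}$ for $i=1,2,3$.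 Then: 1. These operators are well defined: $\mathcal D$ is dense and contains $\Omega$; the series converges unconditionally in norm on every vector of $\mathcal D$; the operator it defines on the space of all vectors on which it converges in this sense is closable; and $\mathcal D$ is a core of its closure, which is again denoted $\hat J^\mu_{r,s}({\bf p})$. The operators $\hat J_{r,s}({\bf p})$ and $\hat S^i_{r,s}({\bf p})$ map $\mathcal D$ into $\mathcal D$. 2. On $\mathcal D$, for all ${\bf p},{\bf p}'\in\tilde\Lambda^*$ (with $\epsilon_{ijk}$ totally antisymmetric, $\epsilon_{123}=1$), $$[\hat J_{r,s}({\bf p}),\hat J_{r,s}({\bf p}')]=r\frac{4\pi p_s}{\tilde a}\Bigl(\frac{L}{2\pi}\Bigr)^2\sum_{n\in\mathbb Z}\delta_{{\bf p}+{\bf p}',\,2\pi n{\bf e}_{-s}/\tilde a},$$ $$[\hat S^i_{r,s}({\bf p}),\hat S^j_{r,s}({\bf p}')]=\mathrm i\sum_{k=1}^3\epsilon_{ijk}\hat S^k_{r,s}({\bf p}+{\bf p}')+\delta_{i,j}\,r\frac{\pi p_s}{\tilde a}\Bigl(\frac{L}{2\pi}\Bigr)^2\sum_{n\in\mathbb Z}\delta_{{\bf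 p}+{\bf p}',\,2\pi n{\bf e}_{-s}/\tilde a},$$ and all other commutators vanish: $[\hat J_{r,s}({\bf p}),\hat S^i_{r',s'}({\bf p}')]=0$ for all $r,s,r',s'$, and $[\hat J_{r,s}({\bf p}),\hat J_{r',s'}({\bf p}')]=0=[\hat S^i_{r,s}({\bf p}),\hat S^j_{r',s'}({\bf p}')]$ whenever $(r,s)\ne(r',s')$. 3. $\hat J_{r,s}({\bf p})^\dagger=\hat J_{r,s}(-{\bf p})$ and $\hat S^i_{r,s}({\bf p})^\dagger=\hat S^i_{r,s}(-{\bf p})$ as closed operators, for all ${\bf p}\in\tilde\Lambda^*$. 4. $\hat J_{r,s}({\bf p})\Omega=0$ and $\hat S^i_{r,s}({\bf p})\Omega=0$ for all ${\bf p}\in\tilde\Lambda^*$ with $rp_s\ge0$. -/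

import Mathlib

open scoped InnerProductSpace ENNReal

noncomputable section

/-! ### Fermion Fock space over a set of one-particle states -/

/-- The Hilbert space `ℓ²(Finset ι)`: the fermion (antisymmetric) Fock space over `ℓ²(ι)` in the
occupation-number representation.  A finite set `S` of one-particle states stands for the basis
vector in which exactly the states of `S` are occupied. -/
abbrev FockSpace (ι : Type) : Type := lp (fun _ : Finset ι => ℂ) 2

open Classical in
/-- The Jordan-Wigner sign `(-1)^#{x ∈ S | x < m}` with respect to a fixed well-order of `ι`. -/
def jwSign {ι : Type} (m : ι) (S : Finset ι) : ℂ :=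
  (-1) ^ (S.filter (fun x => WellOrderingRel x m)).card

open Classical in
/-- Coordinates of the image of `f` under the annihilation operator of the state `m`. -/
def annihilateFun {ι : Type} (m : ι) (f : Finset ι → ℂ) : Finset ι → ℂ :=
  fun S => if m ∈ S then 0 else jwSign m S * f (insert m S)

theorem sum_annihilateFun_le {ι : Type} (m : ι) (f : FockSpace ι) (s : Finset (Finset ι)) :
    ∑ S ∈ s, ‖annihilateFun m f S‖ ^ (2 : ℝ≥0∞).toReal ≤ ‖f‖ ^ (2 : ℝ≥0∞).toReal := by
  classical
  have h2 : (0 : ℝ) < (2 : ℝ≥0∞).toReal := by norm_num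
  have hinj : Set.InjOn (fun S : Finset ι => insert m S) (s.filter (fun S => m ∉ S)) := by
    intro S hS T hT h
    simp only [Finset.coe_filter, Set.mem_ofPred_eq] at hS hT
    have := congrArg (fun U => Finset.erase U m) h
    simpa [Finset.erase_insert hS.2, Finset.erase_insert hT.2] using this
  calc ∑ S ∈ s, ‖annihilateFun m f S‖ ^ (2 : ℝ≥0∞).toReal
      = ∑ S ∈ s.filter (fun S => m ∉ S), ‖f (insert m S)‖ ^ (2 : ℝ≥0∞).toReal := by
        rw [Finset.sum_filter]
        refine Finset.sum_congr rfl fun S _ => ?_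
        by_cases h : m ∈ S
        · simp [annihilateFun, h]
        · simp [annihilateFun, h, jwSign]
    _ = ∑ T ∈ (s.filter (fun S => m ∉ S)).image (fun S => insert m S),
          ‖f T‖ ^ (2 : ℝ≥0∞).toReal := by
        rw [Finset.sum_image hinj]
    _ ≤ ‖f‖ ^ (2 : ℝ≥0∞).toReal := lp.sum_rpow_le_norm_rpow h2 f _

/-- The (bounded) annihilation operator of the one-particle state `m`.
Its adjoint is the creation operator. -/
def annihilate {ι : Type} (m : ι) : FockSpace ι →L[ℂ] FockSpace ι :=
  LinearMap.mkContinuous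
    { toFun := fun f => ⟨annihilateFun m f, memℓp_gen' (sum_annihilateFun_le m f)⟩
      map_add' := by
        intro f g
        ext S
        change annihilateFun m (f + g : FockSpace ι) S = annihilateFun m f S + annihilateFun m g S
        by_cases h : m ∈ S <;> simp [annihilateFun, h, mul_add]
      map_smul' := by
        intro c f
        ext S
        by_cases h : m ∈ S <;> simp [annihilateFun, h, mul_left_comm] }
    1 (by
      intro f
      rw [one_mul]
      exact lp.norm_le_of_forall_sum_le (by norm_num) (norm_nonneg f)
        (sum_annihilateFun_le m f))

open Classical in
/-- The basis vector with occupied set `S`. -/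
def occVec {ι : Type} (S : Finset ι) : FockSpace ι := lp.single 2 S (1 : ℂ)

/-! ### Momenta.  Vectors of the plane are written in the basis `e₊, e₋`,
so that `k s` is the component `k_s` for `s = ±`. -/

/-- The unit vector `e_s`. -/
def unitVec (s : ℤˣ) : ℤˣ → ℝ := Pi.single s 1

/-- Fermion momenta: both components lie in `(2π/L)(ℤ + 1/2)`, and `-π/a ≤ k_{-s} < π/a`. -/
def fermionMomenta (L a : ℝ) (s : ℤˣ) : Set (ℤˣ → ℝ) :=
  {k | (∀ t, ∃ m : ℤ, k t = 2 * Real.pi / L * (m + 1 / 2)) ∧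
    -(Real.pi / a) ≤ k (-s) ∧ k (-s) < Real.pi / a}

/-- Boson momenta: both components lie in `(2π/L)ℤ`. -/
def bosonMomenta (L : ℝ) : Set (ℤˣ → ℝ) :=
  {p | ∀ t, ∃ m : ℤ, p t = 2 * Real.pi / L * m}

/-- Labels of the nodal one-particle states: chirality `r`, Fermi arc index `s`,
spin `α` (`0` is up, `1` is down) and momentum `k`. -/
structure NodalMode (L a : ℝ) where
  r : ℤˣ
  s : ℤˣ
  α : Fin 2
  k : fermionMomenta L a s

/-! ### Nodal fermions and the Dirac vacuum -/

/-- The nodal fermion Fock space built on the Dirac vacuum; a finite set of modes is now a set of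
excitations (particles if `r k_s > 0`, holes if `r k_s < 0`). -/
abbrev NodalFock (L a : ℝ) : Type := FockSpace (NodalMode L a)

/-- The Dirac vacuum `Ω`: no excitations. -/
def diracVacuum (L a : ℝ) : NodalFock L a := occVec ∅

/-- The span of the vectors with finitely many excitations. -/
def finiteExcitations (L a : ℝ) : Submodule ℂ (NodalFock L a) :=
  Submodule.span ℂ (Set.range occVec)

open Classical in
/-- The nodal fermion operator `ψ̂_{r,s,α}(k)`, normalized by
`{ψ̂(k), ψ̂†(k')} = (L/2π)² δ`: it annihilates a particle if `r k_s > 0` and creates a hole if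
`r k_s < 0`. -/
def nodalFermion (L a : ℝ) (r s : ℤˣ) (α : Fin 2) (k : fermionMomenta L a s) :
    NodalFock L a →L[ℂ] NodalFock L a :=
  ((L / (2 * Real.pi) : ℝ) : ℂ) •
    (if 0 < ((r : ℤ) : ℝ) * k.1 s then annihilate ⟨r, s, α, k⟩
      else ContinuousLinearMap.adjoint (annihilate ⟨r, s, α, k⟩))

/-- Normal ordering of a fermion bilinear: `:O: = O - ⟨Ω, O Ω⟩`. -/
def normalOrder {L a : ℝ} (O : NodalFock L a →L[ℂ] NodalFock L a) :
    NodalFock L a →L[ℂ] NodalFock L a :=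
  O - ⟪diracVacuum L a, O (diracVacuum L a)⟫_ℂ • ContinuousLinearMap.id ℂ (NodalFock L a)

/-- `σ⁰ = 1` and the Pauli matrices `σ¹, σ², σ³`. -/
def pauli : Fin 4 → Matrix (Fin 2) (Fin 2) ℂ :=
  ![1, !![0, 1; 1, 0], !![0, -Complex.I; Complex.I, 0], !![1, 0; 0, -1]]

/-- The totally antisymmetric tensor with `ε₁₂₃ = 1` (the indices run over `0, 1, 2` here). -/
def leviCivita (i j k : Fin 3) : ℂ :=
  (((j : ℕ) : ℂ) - ((i : ℕ) : ℂ)) * (((k : ℕ) : ℂ) - ((i : ℕ) : ℂ)) *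
    (((k : ℕ) : ℂ) - ((j : ℕ) : ℂ)) / 2

/-! ### Density and spin operators -/

/-- Summation indices `(α, β, k₁, k₂, n)` of the nodal bilinears. -/
abbrev BilinearIndex (L a : ℝ) (s : ℤˣ) : Type :=
  Fin 2 × Fin 2 × fermionMomenta L a s × fermionMomenta L a s × ℤ

open Classical in
/-- The summand
`(2π/L)² :ψ̂†_{r,s,α}(k₁) σ^μ_{αβ} ψ̂_{r,s,β}(k₂): δ_{k₁ + p, k₂ + 2πn e_{-s}/a}`. -/
def bilinearTerm (L a : ℝ) (μ : Fin 4) (r s : ℤˣ) (p : ℤˣ → ℝ) :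
    BilinearIndex L a s → (NodalFock L a →L[ℂ] NodalFock L a)
  | (α, β, k₁, k₂, n) =>
    if k₁.1 + p = k₂.1 + (2 * Real.pi * n / a) • unitVec (-s) then
      (((2 * Real.pi / L) ^ 2 : ℝ) : ℂ) •
        normalOrder (pauli μ α β •
          (ContinuousLinearMap.adjoint (nodalFermion L a r s α k₁) ∘L nodalFermion L a r s β k₂))
    else 0

/-- The infinite sum of the bilinears as an unbounded operator: its domain consists of all vectors
on which the series converges (unconditionally, in norm). -/
def bilinearSeries (L a : ℝ) (μ : Fin 4) (r s : ℤˣ) (p : ℤˣ → ℝ) :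
    NodalFock L a →ₗ.[ℂ] NodalFock L a where
  domain :=
    { carrier := {φ | Summable fun i => bilinearTerm L a μ r s p i φ}
      zero_mem' := by simp [summable_zero]
      add_mem' := by
        intro φ χ h₁ h₂
        simpa using Summable.add h₁ h₂
      smul_mem' := by
        intro c φ h
        simpa using Summable.const_smul c h }
  toFun :=
    { toFun := fun φ => ∑' i, bilinearTerm L a μ r s p i φ
      map_add' := by
        intro φ χ
        simpa using Summable.tsum_add φ.2 χ.2
      map_smul' := by
        intro c φ
        simpa using Summable.tsum_const_smul c φ.2 }

/-- The nodal current `Ĵ^μ_{r,s}(p)`, the closed operator given by the series. -/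
def nodalCurrent (L a : ℝ) (μ : Fin 4) (r s : ℤˣ) (p : ℤˣ → ℝ) :
    NodalFock L a →ₗ.[ℂ] NodalFock L a :=
  (bilinearSeries L a μ r s p).closure

/-- The nodal density operator `Ĵ_{r,s}(p) = Ĵ⁰_{r,s}(p)`. -/
def nodalDensity (L a : ℝ) (r s : ℤˣ) (p : ℤˣ → ℝ) : NodalFock L a →ₗ.[ℂ] NodalFock L a :=
  nodalCurrent L a 0 r s p

/-- The nodal spin operators `Ŝ^i_{r,s}(p) = Ĵ^i_{r,s}(p) / 2`, `i = 1, 2, 3`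
(the index runs over `0, 1, 2` here). -/
def nodalSpin (L a : ℝ) (i : Fin 3) (r s : ℤˣ) (p : ℤˣ → ℝ) :
    NodalFock L a →ₗ.[ℂ] NodalFock L a :=
  (1 / 2 : ℂ) • nodalCurrent L a i.succ r s p

/-! ### Unbounded operators on common domains -/

open Classical in
/-- The value of an unbounded operator at a vector (only used for vectors in the domain). -/
def act {E : Type} [AddCommGroup E] [Module ℂ E] (A : E →ₗ.[ℂ] E) (φ : E) : E :=
  if h : φ ∈ A.domain then A ⟨φ, h⟩ else 0

/-- The commutator `[A, B]` evaluated at a vector. -/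
def commAt {E : Type} [AddCommGroup E] [Module ℂ E] (A B : E →ₗ.[ℂ] E) (φ : E) : E :=
  act A (act B φ) - act B (act A φ)

/-- `∑_{n ∈ ℤ} δ_{q, 2πn e_{-s}/a}`. -/
def umklappDelta (a : ℝ) (s : ℤˣ) (q : ℤˣ → ℝ) : ℂ :=
  open Classical in ∑' n : ℤ, if q = (2 * Real.pi * n / a) • unitVec (-s) then 1 else 0

end

/-!
On finitely excited vectors the currents are second quantizations of one-particle matrices `U` that
raise the one-particle energy `r k_s` by a fixed amount, and only finitely many modes have energy
in a bounded interval. Hence each series is a finite sum on such a vector, and the second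
quantizations satisfy `[Q U, Q V] = Q [U, V] + κ`, where `κ = ∑ U x y * V y x * (n_x - n_y)` (with
`n` the occupation numbers of the Dirac sea) counts the modes carried across the sea level: this is
the Schwinger term.

The formal adjoint of `Q U` is `Q Uᴴ`. A current shifts the free energy of a vector by a fixed
amount, so it commutes up to a shift with the cutoff to low energies, and truncated vectors have
finitely many excitations. Applied to a vector of the adjoint's domain, this shows that the adjoint
on finitely excited vectors is already the closure of `Q Uᴴ` there, which gives both the core
property and the adjoints.
-/

section UnboundedOperators

open Filter Topology

variable {𝕜 E F I : Type*} [RCLike 𝕜]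
variable [NormedAddCommGroup E] [InnerProductSpace 𝕜 E]
variable [NormedAddCommGroup F] [InnerProductSpace 𝕜 F]

/-- The sum of a family of bounded operators, as an unbounded operator on the space of all vectors
on which the family is unconditionally summable. -/
noncomputable def seriesPMap (T : I → E →L[𝕜] F) : E →ₗ.[𝕜] F where
  domain :=
    { carrier := {φ | Summable fun i => T i φ}
      zero_mem' := by simp [summable_zero]
      add_mem' := fun {φ χ} h₁ h₂ => by simpa using Summable.add h₁ h₂
      smul_mem' := fun c φ h => by simpa using Summable.const_smul c h }
  toFun :=
    { toFun := fun φ => ∑' i, T i φ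
      map_add' := fun φ χ => by simpa using Summable.tsum_add φ.2 χ.2
      map_smul' := fun c φ => by simpa using Summable.tsum_const_smul c φ.2 }

theorem mem_graph_seriesPMap {T : I → E →L[𝕜] F} {φ : E} {v : F} :
    (φ, v) ∈ (seriesPMap T).graph ↔ HasSum (fun i => T i φ) v := by
  rw [LinearPMap.mem_graph_iff]
  constructor
  · rintro ⟨χ, rfl, rfl⟩
    exact Summable.hasSum χ.2
  · exact fun h => ⟨⟨φ, h.summable⟩, rfl, h.tsum_eq⟩

theorem hasSum_seriesPMap (T : I → E →L[𝕜] F) (φ : (seriesPMap T).domain) :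
    HasSum (fun i => T i φ) (seriesPMap T φ) :=
  mem_graph_seriesPMap.mp ((seriesPMap T).mem_graph φ)

theorem seriesPMap_congr {I' : Type*} {T : I → E →L[𝕜] F} {T' : I' → E →L[𝕜] F}
    (h : ∀ φ v, HasSum (fun i => T i φ) v ↔ HasSum (fun i => T' i φ) v) :
    seriesPMap T = seriesPMap T' := by
  refine LinearPMap.eq_of_eq_graph (Submodule.ext fun ⟨φ, v⟩ => ?_)
  rw [mem_graph_seriesPMap, mem_graph_seriesPMap, h]

theorem isFormalAdjoint_seriesPMap_adjoint [CompleteSpace E] [CompleteSpace F]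
    (T : I → E →L[𝕜] F) :
    (seriesPMap fun i => (T i).adjoint).IsFormalAdjoint (seriesPMap T) := fun χ φ => by
  have hφ := (hasSum_seriesPMap T φ).mapL (innerSL 𝕜 (χ : F))
  have hχ := ((hasSum_seriesPMap _ χ).mapL (innerSL 𝕜 (φ : E))).star
  simp only [innerSL_apply_apply, ContinuousLinearMap.adjoint_inner_right] at hφ hχ
  simpa using hχ.unique (by simpa using hφ)

theorem closure_le_of_isClosed {f g : E →ₗ.[𝕜] F} (hfg : f ≤ g) (hg : g.IsClosed) :
    f.closure ≤ g := by
  have hf := hg.isClosable.leIsClosable hfg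
  rw [← LinearPMap.le_graph_iff, ← hf.graph_closure_eq_closure_graph]
  exact Submodule.topologicalClosure_minimal _ (LinearPMap.le_graph_iff.mpr hfg) hg

theorem adjoint_closure_eq [CompleteSpace E] {f : E →ₗ.[𝕜] F} (hd : Dense (f.domain : Set E))
    (hf : f.IsClosable) : f.closure.adjoint = f.adjoint := by
  have hd' : Dense (f.closure.domain : Set E) := hd.mono f.le_closure.1
  have hformal := LinearPMap.adjoint_isFormalAdjoint hd
  apply le_antisymm
  · refine LinearPMap.IsFormalAdjoint.le_adjoint hd fun x y => ?_
    rw [f.le_closure.2 (x := x) (y := ⟨x, f.le_closure.1 x.2⟩) rfl]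
    exact (LinearPMap.adjoint_isFormalAdjoint hd').symm ⟨x, _⟩ y
  · refine LinearPMap.IsFormalAdjoint.le_adjoint hd' fun x y => ?_
    have hx : ((x : E), f.closure x) ∈ closure (f.graph : Set (E × F)) := by
      rw [← Submodule.topologicalClosure_coe, hf.graph_closure_eq_closure_graph]
      exact f.closure.mem_graph x
    refine closure_minimal (t := {p | ⟪p.2, (y : F)⟫_𝕜 = ⟪p.1, f.adjoint y⟫_𝕜}) ?_
      (isClosed_eq (by fun_prop) (by fun_prop)) hx
    rintro ⟨_, _⟩ hp
    obtain ⟨z, rfl, rfl⟩ := f.mem_graph_iff.mp hp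
    exact hformal.symm z y

theorem adjoint_smul [CompleteSpace E] {f : E →ₗ.[𝕜] F} (hf : Dense (f.domain : Set E)) {c : 𝕜}
    (hc : c ≠ 0) : (c • f).adjoint = starRingEnd 𝕜 c • f.adjoint := by
  have smul_adjoint_le : ∀ {g : E →ₗ.[𝕜] F} (d : 𝕜), Dense (g.domain : Set E) →
      starRingEnd 𝕜 d • g.adjoint ≤ (d • g).adjoint := fun {g} d hg =>
    LinearPMap.IsFormalAdjoint.le_adjoint hg fun x y => by
      have h := (LinearPMap.adjoint_isFormalAdjoint hg).symm x y
      simp only [LinearPMap.smul_apply, inner_smul_left, inner_smul_right, h]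
  refine le_antisymm ?_ (smul_adjoint_le c hf)
  have h := smul_adjoint_le (g := c • f) c⁻¹ hf
  rw [inv_smul_smul₀ hc] at h
  refine ⟨h.1, fun x y hxy => ?_⟩
  rw [LinearPMap.smul_apply, ← h.2 (x := x) hxy, LinearPMap.smul_apply, smul_smul, ← map_mul,
    mul_inv_cancel₀ hc, map_one, one_smul]

theorem graph_domRestrict_span {f : E →ₗ.[𝕜] F} {s : Set E}
    (hs : Submodule.span 𝕜 s ≤ f.domain) :
    (f.domRestrict (Submodule.span 𝕜 s)).graph = Submodule.span 𝕜 {p ∈ f.graph | p.1 ∈ s} := by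
  apply le_antisymm
  · suffices h : ∀ x (hx : x ∈ Submodule.span 𝕜 s), (x, f ⟨x, hs hx⟩) ∈
        Submodule.span 𝕜 {p ∈ f.graph | p.1 ∈ s} by
      rintro ⟨_, _⟩ hp
      obtain ⟨⟨x, hx⟩, rfl, rfl⟩ := (LinearPMap.mem_graph_iff _).mp hp
      exact h x hx.1
    intro x hx
    induction hx using Submodule.span_induction with
    | mem x hx => exact Submodule.subset_span ⟨f.mem_graph ⟨x, _⟩, hx⟩
    | zero =>
      convert Submodule.zero_mem _ using 1
      exact Prod.ext rfl f.map_zero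
    | add x y hx hy ihx ihy =>
      convert Submodule.add_mem _ ihx ihy using 1
      exact Prod.ext rfl (f.map_add ⟨x, hs hx⟩ ⟨y, hs hy⟩)
    | smul c x hx ih =>
      convert Submodule.smul_mem _ c ih using 1
      exact Prod.ext rfl (f.map_smul c ⟨x, hs hx⟩)
  · refine Submodule.span_le.mpr ?_
    rintro ⟨_, _⟩ ⟨hp, hx⟩
    obtain ⟨⟨x, hx'⟩, rfl, rfl⟩ := f.mem_graph_iff.mp hp
    exact (f.domRestrict _).mem_graph ⟨x, Submodule.subset_span hx, hx'⟩

theorem dense_domain_domRestrict {D : Submodule 𝕜 E} {f : E →ₗ.[𝕜] F} (hD : Dense (D : Set E))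
    (hf : D ≤ f.domain) : Dense ((f.domRestrict D).domain : Set E) := by
  rwa [LinearPMap.domRestrict_domain, inf_eq_left.mpr hf]

theorem domRestrict_eq_of_le {D : Submodule 𝕜 E} {f g : E →ₗ.[𝕜] F} (hfg : f ≤ g)
    (hf : D ≤ f.domain) : g.domRestrict D = f.domRestrict D :=
  LinearPMap.ext (by simp [inf_eq_left.mpr hf, inf_eq_left.mpr (hf.trans hfg.1)])
    fun x hx hx' => (hfg.2 (x := ⟨x, hx'.2⟩) (y := ⟨x, hx.2⟩) rfl).symm

theorem isClosable_of_isFormalAdjoint [CompleteSpace E] {A : E →ₗ.[𝕜] F} {B : F →ₗ.[𝕜] E}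
    (hAB : A.IsFormalAdjoint B) (hA : Dense (A.domain : Set E)) : B.IsClosable :=
  (LinearPMap.adjoint_isClosed hA).isClosable.leIsClosable (hAB.le_adjoint hA)

-- The truncations `P i ψ` of a vector of `A†` converge to it in graph norm, since
-- `⟪Q i (A† ψ), x⟫ = ⟪ψ, A (Q i x)⟫ = ⟪P i ψ, A x⟫` identifies `B (P i ψ)` with `Q i (A† ψ)`.
theorem adjoint_le_closure_of_truncation [CompleteSpace E] {A : E →ₗ.[𝕜] F} {B : F →ₗ.[𝕜] E}
    (hA : Dense (A.domain : Set E)) (hAB : A.IsFormalAdjoint B) {J : Type*} {l : Filter J}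
    [l.NeBot] {P : J → F →L[𝕜] F} {Q : J → E →L[𝕜] E}
    (hPs : ∀ i, (P i : F →ₗ[𝕜] F).IsSymmetric) (hQs : ∀ i, (Q i : E →ₗ[𝕜] E).IsSymmetric)
    (hP : ∀ x, Tendsto (fun i => P i x) l (𝓝 x)) (hQ : ∀ x, Tendsto (fun i => Q i x) l (𝓝 x))
    (hB : ∀ i x, P i x ∈ B.domain) (hcomm : ∀ i, ∀ p ∈ A.graph, (Q i p.1, P i p.2) ∈ A.graph) :
    A.adjoint ≤ B.closure := by
  have hcl := isClosable_of_isFormalAdjoint hAB hA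
  rw [← LinearPMap.le_graph_iff, ← hcl.graph_closure_eq_closure_graph]
  rintro ⟨_, _⟩ hp
  obtain ⟨ψ, rfl, rfl⟩ := A.adjoint.mem_graph_iff.mp hp
  refine mem_closure_of_tendsto ((hP ψ).prodMk_nhds (hQ (A.adjoint ψ))) (.of_forall fun i => ?_)
  refine B.mem_graph_iff.mpr ⟨⟨P i ψ, hB i ψ⟩, rfl, hA.eq_of_inner_right 𝕜 fun x hx => ?_⟩
  obtain ⟨x', hx', hQx⟩ := A.mem_graph_iff.mp (hcomm i _ (A.mem_graph ⟨x, hx⟩))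
  calc ⟪x, B ⟨P i ψ, hB i ψ⟩⟫_𝕜
      = ⟪A ⟨x, hx⟩, P i ψ⟫_𝕜 := (hAB ⟨x, hx⟩ ⟨P i ψ, hB i ψ⟩).symm
    _ = ⟪A x', (ψ : F)⟫_𝕜 := by rw [hQx]; exact (hPs i _ _).symm
    _ = ⟪(x' : E), A.adjoint ψ⟫_𝕜 := (LinearPMap.adjoint_isFormalAdjoint hA).symm x' ψ
    _ = ⟪x, Q i (A.adjoint ψ)⟫_𝕜 := by rw [hx']; exact hQs i _ _

section Core

variable [CompleteSpace E] {A : E →ₗ.[𝕜] F} {B : F →ₗ.[𝕜] E} {D : Submodule 𝕜 E}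
  {D' : Submodule 𝕜 F}

theorem le_adjoint_domRestrict (hAB : A.IsFormalAdjoint B) (hD : Dense (D : Set E))
    (hA : D ≤ A.domain) : B ≤ (A.domRestrict D).adjoint :=
  LinearPMap.IsFormalAdjoint.le_adjoint (dense_domain_domRestrict hD hA) fun x y =>
    hAB ⟨x, x.2.2⟩ y

theorem closure_eq_adjoint_domRestrict (hAB : A.IsFormalAdjoint B) (hD : Dense (D : Set E))
    (hA : D ≤ A.domain) (h : (A.domRestrict D).adjoint ≤ (B.domRestrict D').closure) :
    B.closure = (A.domRestrict D).adjoint := by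
  have hcl := LinearPMap.adjoint_isClosed (dense_domain_domRestrict hD hA)
  have hle := le_adjoint_domRestrict hAB hD hA
  refine le_antisymm (closure_le_of_isClosed hle hcl) (h.trans ?_)
  exact (hcl.isClosable.leIsClosable hle).closure_mono LinearPMap.domRestrict_le

theorem hasCore_closure (hAB : A.IsFormalAdjoint B) (hD : Dense (D : Set E))
    (hA : D ≤ A.domain) (hB : D' ≤ B.domain)
    (h : (A.domRestrict D).adjoint ≤ (B.domRestrict D').closure) : B.closure.HasCore D' where
  le_domain := hB.trans B.le_closure.1
  closure_eq := by
    have hcl := isClosable_of_isFormalAdjoint hAB (hD.mono hA)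
    rw [domRestrict_eq_of_le B.le_closure hB]
    refine le_antisymm (hcl.closure_mono LinearPMap.domRestrict_le) ?_
    exact (closure_eq_adjoint_domRestrict hAB hD hA h).trans_le h

theorem adjoint_closure_eq_closure [CompleteSpace F] (hAB : A.IsFormalAdjoint B)
    (hD : Dense (D : Set E)) (hD' : Dense (D' : Set F)) (hA : D ≤ A.domain) (hB : D' ≤ B.domain)
    (h : (A.domRestrict D).adjoint ≤ (B.domRestrict D').closure)
    (h' : (B.domRestrict D').adjoint ≤ (A.domRestrict D).closure) :
    B.closure.adjoint = A.closure := by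
  have hcl := isClosable_of_isFormalAdjoint hAB (hD.mono hA)
  rw [closure_eq_adjoint_domRestrict hAB.symm hD' hB h',
    ← (hasCore_closure hAB hD hA hB h).closure_eq, domRestrict_eq_of_le B.le_closure hB]
  exact adjoint_closure_eq (dense_domain_domRestrict hD' hB)
    (hcl.leIsClosable LinearPMap.domRestrict_le)

end Core

section Action

variable {H : Type} [AddCommGroup H] [Module ℂ H] {A A' B B' : H →ₗ.[ℂ] H} {D : Submodule ℂ H}
  {φ v : H}

theorem act_eq_of_mem_graph (h : (φ, v) ∈ A.graph) : act A φ = v := by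
  obtain ⟨χ, rfl, rfl⟩ := A.mem_graph_iff.mp h
  exact dif_pos χ.2

theorem act_eq_of_le (h : A ≤ B) (hφ : φ ∈ A.domain) : act B φ = act A φ := by
  rw [act_eq_of_mem_graph (A.mem_graph ⟨φ, hφ⟩)]
  exact act_eq_of_mem_graph (LinearPMap.le_graph_of_le h (A.mem_graph ⟨φ, hφ⟩))

theorem act_smul (c : ℂ) (A : H →ₗ.[ℂ] H) (φ : H) : act (c • A) φ = c • act A φ := by
  rw [act, act, smul_dite, smul_zero]
  rfl

theorem commAt_congr (hA : ∀ φ ∈ D, act A φ = act A' φ) (hB : ∀ φ ∈ D, act B φ = act B' φ)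
    (hA' : ∀ φ ∈ D, act A' φ ∈ D) (hB' : ∀ φ ∈ D, act B' φ ∈ D) (hφ : φ ∈ D) :
    commAt A B φ = commAt A' B' φ := by
  rw [commAt, hA φ hφ, hB φ hφ, hA _ (hB' φ hφ), hB _ (hA' φ hφ), commAt]

end Action

end UnboundedOperators

section OccupationNumbers

variable {ι : Type} {m n : ι} {S T : Finset ι}

theorem exists_eq_cons_of_mem (h : m ∈ S) : ∃ T hT, S = Finset.cons m T hT := by
  classical
  exact ⟨S.erase m, S.notMem_erase m, by rw [Finset.cons_eq_insert, Finset.insert_erase h]⟩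

theorem cons_injective (hS : m ∉ S) (hT : m ∉ T) (h : S.cons m hS = T.cons m hT) : S = T := by
  classical
  rw [← Finset.erase_cons hS, h, Finset.erase_cons]

theorem jwSign_mul_self (m : ι) (S : Finset ι) : jwSign m S * jwSign m S = 1 := by
  rw [jwSign, ← mul_pow, neg_one_mul, neg_neg, one_pow]

theorem conj_jwSign (m : ι) (S : Finset ι) : starRingEnd ℂ (jwSign m S) = jwSign m S := by
  simp [jwSign]

open Classical in
theorem jwSign_cons (m : ι) (hn : n ∉ S) :
    jwSign m (S.cons n hn) = (if WellOrderingRel n m then -1 else 1) * jwSign m S := by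
  rw [jwSign, jwSign, Finset.filter_cons]
  split_ifs with h
  · rw [Finset.card_cons, pow_succ']
  · rw [one_mul]

theorem jwSign_mul_cons_swap (hmn : m ≠ n) (hm : m ∉ S) (hn : n ∉ S) :
    jwSign m S * jwSign n (S.cons m hm) = -(jwSign n S * jwSign m (S.cons n hn)) := by
  rw [jwSign_cons, jwSign_cons]
  rcases trichotomous_of WellOrderingRel m n with h | h | h
  · rw [if_pos h, if_neg (asymm_of WellOrderingRel h)]
    ring
  · exact absurd h hmn
  · rw [if_pos h, if_neg (asymm_of WellOrderingRel h)]
    ring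

theorem jwSign_mul_jwSign (hmn : m ≠ n) (hm : m ∉ S) (hn : n ∉ S) :
    jwSign m S * jwSign n S = -(jwSign n (S.cons m hm) * jwSign m (S.cons n hn)) := by
  linear_combination (jwSign m S * jwSign m (S.cons n hn)) * jwSign_mul_cons_swap hmn hm hn
    - jwSign m S * jwSign n S * jwSign_mul_self m (S.cons n hn)
    - (jwSign n (S.cons m hm) * jwSign m (S.cons n hn)) * jwSign_mul_self m S

theorem occVec_self (S : Finset ι) : occVec S S = 1 := by
  classical
  rw [occVec, lp.single_apply, Pi.single_eq_same]

theorem occVec_of_ne (h : T ≠ S) : occVec S T = 0 := by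
  classical
  rw [occVec, lp.single_apply, Pi.single_eq_of_ne h]

theorem inner_occVec_left (S : Finset ι) (f : FockSpace ι) : ⟪occVec S, f⟫_ℂ = f S := by
  classical
  rw [occVec, lp.inner_single_left]
  simp

/-- The occupation-number basis of Fock space. -/
noncomputable def occBasis (ι : Type) : HilbertBasis (Finset ι) ℂ (FockSpace ι) :=
  .ofRepr (LinearIsometryEquiv.refl ℂ _)

theorem coe_occBasis : ⇑(occBasis ι) = occVec := by
  classical
  exact funext fun S => ((occBasis ι).repr_symm_single S).symm

theorem dense_span_occVec :
    Dense (Submodule.span ℂ (Set.range (occVec (ι := ι))) : Set (FockSpace ι)) := by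
  rw [Submodule.dense_iff_topologicalClosure_eq_top, ← coe_occBasis]
  exact (occBasis ι).dense_span

theorem ext_occVec {A B : FockSpace ι →L[ℂ] FockSpace ι}
    (h : ∀ S, A (occVec S) = B (occVec S)) : A = B :=
  ContinuousLinearMap.ext_on dense_span_occVec (Set.forall_mem_range.mpr h)

theorem annihilate_apply_of_mem (hm : m ∈ S) (f : FockSpace ι) : annihilate m f S = 0 :=
  if_pos hm

theorem annihilate_apply_of_notMem (hm : m ∉ S) (f : FockSpace ι) :
    annihilate m f S = jwSign m S * f (S.cons m hm) := by
  classical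
  rw [Finset.cons_eq_insert]
  exact if_neg hm

theorem annihilate_occVec_of_notMem (hm : m ∉ S) : annihilate m (occVec S) = 0 := by
  ext T
  by_cases hT : m ∈ T
  · exact annihilate_apply_of_mem hT _
  · have hne : T.cons m hT ≠ S := fun h => hm (h ▸ Finset.mem_cons_self m T)
    rw [annihilate_apply_of_notMem hT, occVec_of_ne hne, mul_zero, lp.coeFn_zero, Pi.zero_apply]

theorem annihilate_occVec_cons (hm : m ∉ S) :
    annihilate m (occVec (S.cons m hm)) = jwSign m S • occVec S := by
  ext T
  rw [lp.coeFn_smul, Pi.smul_apply, smul_eq_mul]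
  by_cases hTS : T = S
  · rw [hTS, annihilate_apply_of_notMem hm, occVec_self, occVec_self]
  rw [occVec_of_ne hTS, mul_zero]
  by_cases hT : m ∈ T
  · exact annihilate_apply_of_mem hT _
  · rw [annihilate_apply_of_notMem hT, occVec_of_ne (mt (cons_injective hT hm) hTS), mul_zero]

theorem adjoint_annihilate_apply (m : ι) (S T : Finset ι) :
    (annihilate m).adjoint (occVec S) T = starRingEnd ℂ (annihilate m (occVec T) S) := by
  rw [← inner_occVec_left, ContinuousLinearMap.adjoint_inner_right, ← inner_conj_symm,
    inner_occVec_left]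

theorem adjoint_annihilate_occVec_of_mem (hm : m ∈ S) :
    (annihilate m).adjoint (occVec S) = 0 := by
  ext T
  rw [adjoint_annihilate_apply, annihilate_apply_of_mem hm, map_zero, lp.coeFn_zero,
    Pi.zero_apply]

theorem adjoint_annihilate_occVec_of_notMem (hm : m ∉ S) :
    (annihilate m).adjoint (occVec S) = jwSign m S • occVec (S.cons m hm) := by
  ext T
  rw [adjoint_annihilate_apply, annihilate_apply_of_notMem hm, map_mul, conj_jwSign,
    lp.coeFn_smul, Pi.smul_apply, smul_eq_mul]
  by_cases hTS : T = S.cons m hm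
  · rw [hTS, occVec_self, map_one]
  · rw [occVec_of_ne hTS, occVec_of_ne (Ne.symm hTS), map_zero]

theorem annihilate_annihilate_occVec_of_notMem (hm : m ∉ S) (n : ι) :
    annihilate m (annihilate n (occVec S)) = 0 := by
  by_cases hn : n ∈ S
  · obtain ⟨T, hT, rfl⟩ := exists_eq_cons_of_mem hn
    have hmT : m ∉ T := fun h => hm (Finset.mem_cons_of_mem h)
    rw [annihilate_occVec_cons, map_smul, annihilate_occVec_of_notMem hmT, smul_zero]
  · rw [annihilate_occVec_of_notMem hn, map_zero]

theorem annihilate_mul_self (m : ι) : annihilate m * annihilate m = 0 := by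
  refine ext_occVec fun S => ?_
  by_cases hm : m ∈ S
  · obtain ⟨T, hT, rfl⟩ := exists_eq_cons_of_mem hm
    change annihilate m (annihilate m (occVec (T.cons m hT))) = 0
    rw [annihilate_occVec_cons, map_smul,
      annihilate_occVec_of_notMem hT, smul_zero]
  · exact annihilate_annihilate_occVec_of_notMem hm m

theorem annihilate_anticomm (m n : ι) :
    annihilate m * annihilate n + annihilate n * annihilate m = 0 := by
  rcases eq_or_ne m n with rfl | hmn
  · rw [annihilate_mul_self, add_zero]
  refine ext_occVec fun S => ?_
  change annihilate m (annihilate n (occVec S)) + annihilate n (annihilate m (occVec S)) = 0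
  by_cases hm : m ∈ S
  · obtain ⟨T, hmT, rfl⟩ := exists_eq_cons_of_mem hm
    by_cases hn : n ∈ T
    · obtain ⟨R, hnR, rfl⟩ := exists_eq_cons_of_mem hn
      have hmR : m ∉ R := fun h => hmT (Finset.mem_cons_of_mem h)
      rw [annihilate_occVec_cons, map_smul, annihilate_occVec_cons, Finset.cons_swap hnR hmT,
        annihilate_occVec_cons, map_smul, annihilate_occVec_cons, smul_smul, smul_smul, ← add_smul,
        mul_comm, jwSign_mul_cons_swap hmn hmR hnR, mul_comm (jwSign n R), neg_add_cancel,
        zero_smul]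
    · have hn' : n ∉ T.cons m hmT := by simp [hmn.symm, hn]
      rw [annihilate_occVec_of_notMem hn', annihilate_annihilate_occVec_of_notMem hn', map_zero,
        add_zero]
  · rw [annihilate_occVec_of_notMem hm, annihilate_annihilate_occVec_of_notMem hm, map_zero,
      add_zero]

theorem annihilate_create_anticomm_self (m : ι) :
    annihilate m * (annihilate m).adjoint + (annihilate m).adjoint * annihilate m = 1 := by
  refine ext_occVec fun S => ?_
  change annihilate m ((annihilate m).adjoint (occVec S)) +
    (annihilate m).adjoint (annihilate m (occVec S)) = occVec S
  by_cases hm : m ∈ S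
  · obtain ⟨T, hT, rfl⟩ := exists_eq_cons_of_mem hm
    rw [adjoint_annihilate_occVec_of_mem hm, annihilate_occVec_cons, map_smul,
      adjoint_annihilate_occVec_of_notMem hT, smul_smul, jwSign_mul_self, map_zero, zero_add,
      one_smul]
  · rw [annihilate_occVec_of_notMem hm, adjoint_annihilate_occVec_of_notMem hm, map_smul,
      annihilate_occVec_cons, smul_smul, jwSign_mul_self, map_zero, add_zero, one_smul]

theorem annihilate_create_anticomm (hmn : m ≠ n) :
    annihilate m * (annihilate n).adjoint + (annihilate n).adjoint * annihilate m = 0 := by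
  refine ext_occVec fun S => ?_
  change annihilate m ((annihilate n).adjoint (occVec S)) +
    (annihilate n).adjoint (annihilate m (occVec S)) = 0
  by_cases hn : n ∈ S <;> by_cases hm : m ∈ S
  · obtain ⟨T, hT, rfl⟩ := exists_eq_cons_of_mem hm
    have hnT : n ∈ T := (Finset.mem_cons.mp hn).resolve_left hmn.symm
    rw [adjoint_annihilate_occVec_of_mem hn, annihilate_occVec_cons, map_smul,
      adjoint_annihilate_occVec_of_mem hnT, smul_zero, map_zero, add_zero]
  · rw [adjoint_annihilate_occVec_of_mem hn, annihilate_occVec_of_notMem hm, map_zero, map_zero,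
      add_zero]
  · obtain ⟨T, hT, rfl⟩ := exists_eq_cons_of_mem hm
    have hnT : n ∉ T := fun h => hn (Finset.mem_cons_of_mem h)
    rw [adjoint_annihilate_occVec_of_notMem hn, map_smul, Finset.cons_swap hT hn,
      annihilate_occVec_cons, annihilate_occVec_cons, map_smul,
      adjoint_annihilate_occVec_of_notMem hnT, smul_smul, smul_smul, ← add_smul,
      jwSign_mul_jwSign hmn hT hnT, add_neg_cancel, zero_smul]
  · have hm' : m ∉ S.cons n hn := by simp [hmn, hm]
    rw [adjoint_annihilate_occVec_of_notMem hn, map_smul, annihilate_occVec_of_notMem hm',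
      annihilate_occVec_of_notMem hm, smul_zero, map_zero, add_zero]

variable {𝒮 𝒯 : Set (Finset ι)} {φ : FockSpace ι}

theorem map_mem_span_occVec {A : FockSpace ι →L[ℂ] FockSpace ι}
    (h : ∀ S ∈ 𝒮, A (occVec S) ∈ Submodule.span ℂ (occVec '' 𝒯))
    (hφ : φ ∈ Submodule.span ℂ (occVec '' 𝒮)) : A φ ∈ Submodule.span ℂ (occVec '' 𝒯) := by
  have hle : Submodule.span ℂ (occVec '' 𝒮) ≤
      (Submodule.span ℂ (occVec '' 𝒯)).comap (A : FockSpace ι →ₗ[ℂ] FockSpace ι) :=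
    Submodule.span_le.mpr (Set.forall_mem_image.mpr h)
  exact hle hφ

theorem annihilate_mem_span_occVec (h : ∀ S hm, S.cons m hm ∈ 𝒮 → S ∈ 𝒯)
    (hφ : φ ∈ Submodule.span ℂ (occVec '' 𝒮)) :
    annihilate m φ ∈ Submodule.span ℂ (occVec '' 𝒯) := by
  refine map_mem_span_occVec (fun S hS => ?_) hφ
  by_cases hm : m ∈ S
  · obtain ⟨T, hT, rfl⟩ := exists_eq_cons_of_mem hm
    rw [annihilate_occVec_cons]
    exact Submodule.smul_mem _ _ (Submodule.subset_span ⟨T, h T hT hS, rfl⟩)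
  · rw [annihilate_occVec_of_notMem hm]
    exact Submodule.zero_mem _

theorem adjoint_annihilate_mem_span_occVec (h : ∀ S hm, S ∈ 𝒮 → S.cons m hm ∈ 𝒯)
    (hφ : φ ∈ Submodule.span ℂ (occVec '' 𝒮)) :
    (annihilate m).adjoint φ ∈ Submodule.span ℂ (occVec '' 𝒯) := by
  refine map_mem_span_occVec (fun S hS => ?_) hφ
  by_cases hm : m ∈ S
  · rw [adjoint_annihilate_occVec_of_mem hm]
    exact Submodule.zero_mem _
  · rw [adjoint_annihilate_occVec_of_notMem hm]
    exact Submodule.smul_mem _ _ (Submodule.subset_span ⟨_, h S hm hS, rfl⟩)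

/-- The orthogonal projection onto the span of the basis vectors with occupied set in `W`. -/
noncomputable def occProj (W : Finset (Finset ι)) : FockSpace ι →L[ℂ] FockSpace ι :=
  ∑ S ∈ W, InnerProductSpace.rankOne ℂ (occVec S) (occVec S)

theorem occProj_apply (W : Finset (Finset ι)) (φ : FockSpace ι) :
    occProj W φ = ∑ S ∈ W, φ S • occVec S := by
  simp only [occProj, sum_apply, InnerProductSpace.rankOne_apply,
    inner_occVec_left]

theorem occProj_occVec_of_mem {W : Finset (Finset ι)} (hS : S ∈ W) :
    occProj W (occVec S) = occVec S := by
  rw [occProj_apply, Finset.sum_eq_single_of_mem S hS fun T _ hTS => ?_]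
  · rw [occVec_self, one_smul]
  · rw [occVec_of_ne hTS, zero_smul]

theorem occProj_occVec_of_notMem {W : Finset (Finset ι)} (hS : S ∉ W) :
    occProj W (occVec S) = 0 := by
  rw [occProj_apply]
  exact Finset.sum_eq_zero fun T hT => by rw [occVec_of_ne (ne_of_mem_of_not_mem hT hS), zero_smul]

theorem isSymmetric_occProj (W : Finset (Finset ι)) :
    (occProj W : FockSpace ι →ₗ[ℂ] FockSpace ι).IsSymmetric := fun φ χ => by
  simp [occProj_apply, sum_inner, inner_sum, inner_smul_left, inner_smul_right, mul_comm,
    inner_occVec_left, ← inner_conj_symm φ (occVec _)]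

theorem occProj_mem_span (W : Finset (Finset ι)) (φ : FockSpace ι) :
    occProj W φ ∈ Submodule.span ℂ (Set.range occVec) := by
  rw [occProj_apply]
  exact Submodule.sum_mem _ fun S _ => Submodule.smul_mem _ _ (Submodule.subset_span ⟨S, rfl⟩)

theorem tendsto_occProj (φ : FockSpace ι) :
    Filter.Tendsto (fun W => occProj W φ) Filter.atTop (nhds φ) := by
  have h : HasSum (fun S => φ S • occBasis ι S) φ := (occBasis ι).hasSum_repr φ
  simp only [coe_occBasis, HasSum, SummationFilter.unconditional_filter] at h
  simpa only [occProj_apply] using h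

end OccupationNumbers

section DiracSea

variable {X : Type}

/-- The fermion field of a signed one-particle energy `e`, in terms of the excitations of the Dirac
sea: it annihilates a particle if `0 < e x` and creates a hole otherwise. -/
noncomputable def fieldOp (e : X → ℝ) (x : X) : FockSpace X →L[ℂ] FockSpace X :=
  open Classical in if 0 < e x then annihilate x else (annihilate x).adjoint

/-- The occupation number of the state `x` in the Dirac sea. -/
noncomputable def seaOcc (e : X → ℝ) (x : X) : ℂ :=
  open Classical in if 0 < e x then 0 else 1

/-- The normal-ordered bilinear `:b†(x) b(y):` of the fermion field `b`. -/
noncomputable def normalBilinear (e : X → ℝ) (x y : X) : FockSpace X →L[ℂ] FockSpace X :=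
  star (fieldOp e x) * fieldOp e y -
    ⟪occVec ∅, (star (fieldOp e x) * fieldOp e y) (occVec ∅)⟫_ℂ • 1

variable {e : X → ℝ} {x y : X}

theorem fieldOp_of_pos (hx : 0 < e x) : fieldOp e x = annihilate x := if_pos hx

theorem fieldOp_of_not_pos (hx : ¬0 < e x) : fieldOp e x = star (annihilate x) := if_neg hx

theorem seaOcc_of_pos (hx : 0 < e x) : seaOcc e x = 0 := if_pos hx

theorem seaOcc_of_not_pos (hx : ¬0 < e x) : seaOcc e x = 1 := if_neg hx

theorem star_annihilate_anticomm (x y : X) :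
    star (annihilate x) * star (annihilate y) + star (annihilate y) * star (annihilate x) = 0 := by
  simpa only [star_add, star_mul, star_zero] using congrArg star (annihilate_anticomm y x)

theorem fieldOp_anticomm (e : X → ℝ) (x y : X) :
    fieldOp e x * fieldOp e y + fieldOp e y * fieldOp e x = 0 := by
  by_cases hx : 0 < e x <;> by_cases hy : 0 < e y
  · rw [fieldOp_of_pos hx, fieldOp_of_pos hy, annihilate_anticomm]
  · rw [fieldOp_of_pos hx, fieldOp_of_not_pos hy]
    exact annihilate_create_anticomm fun h => hy (h ▸ hx)
  · rw [fieldOp_of_not_pos hx, fieldOp_of_pos hy, add_comm]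
    exact annihilate_create_anticomm fun h => hx (h ▸ hy)
  · rw [fieldOp_of_not_pos hx, fieldOp_of_not_pos hy, star_annihilate_anticomm]

theorem star_fieldOp_anticomm (e : X → ℝ) (x y : X) :
    star (fieldOp e x) * star (fieldOp e y) + star (fieldOp e y) * star (fieldOp e x) = 0 := by
  simpa only [star_add, star_mul, star_zero] using congrArg star (fieldOp_anticomm e y x)

theorem fieldOp_star_anticomm_self (e : X → ℝ) (x : X) :
    fieldOp e x * star (fieldOp e x) + star (fieldOp e x) * fieldOp e x = 1 := by
  by_cases hx : 0 < e x
  · rw [fieldOp_of_pos hx]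
    exact annihilate_create_anticomm_self x
  · rw [fieldOp_of_not_pos hx, star_star, add_comm]
    exact annihilate_create_anticomm_self x

theorem fieldOp_star_anticomm (e : X → ℝ) (hxy : x ≠ y) :
    fieldOp e x * star (fieldOp e y) + star (fieldOp e y) * fieldOp e x = 0 := by
  by_cases hx : 0 < e x <;> by_cases hy : 0 < e y
  · rw [fieldOp_of_pos hx, fieldOp_of_pos hy]
    exact annihilate_create_anticomm hxy
  · rw [fieldOp_of_pos hx, fieldOp_of_not_pos hy, star_star, annihilate_anticomm]
  · rw [fieldOp_of_not_pos hx, fieldOp_of_pos hy, star_annihilate_anticomm]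
  · rw [fieldOp_of_not_pos hx, fieldOp_of_not_pos hy, star_star, add_comm]
    exact annihilate_create_anticomm hxy.symm

theorem fieldOp_occVec_empty (hx : 0 < e x) : fieldOp e x (occVec ∅) = 0 := by
  rw [fieldOp_of_pos hx, annihilate_occVec_of_notMem (Finset.notMem_empty x)]

theorem star_fieldOp_occVec_empty (hx : ¬0 < e x) : star (fieldOp e x) (occVec ∅) = 0 := by
  rw [fieldOp_of_not_pos hx, star_star, annihilate_occVec_of_notMem (Finset.notMem_empty x)]

theorem inner_occVec_empty_star_fieldOp_mul [DecidableEq X] (e : X → ℝ) (x y : X) :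
    ⟪occVec ∅, (star (fieldOp e x) * fieldOp e y) (occVec ∅)⟫_ℂ =
      if x = y then seaOcc e x else 0 := by
  change ⟪occVec ∅, (fieldOp e x).adjoint (fieldOp e y (occVec ∅))⟫_ℂ = _
  by_cases hx : 0 < e x
  · rw [ContinuousLinearMap.adjoint_inner_right, fieldOp_occVec_empty hx, inner_zero_left,
      seaOcc_of_pos hx, ite_self]
  have anticomm_apply : star (fieldOp e x) (fieldOp e y (occVec ∅)) =
      (fieldOp e y * star (fieldOp e x) + star (fieldOp e x) * fieldOp e y) (occVec ∅) := by
    change _ = fieldOp e y (star (fieldOp e x) (occVec ∅)) + _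
    rw [star_fieldOp_occVec_empty hx, map_zero, zero_add]
    rfl
  change ⟪occVec ∅, star (fieldOp e x) (fieldOp e y (occVec ∅))⟫_ℂ = _
  rw [anticomm_apply]
  split_ifs with hxy
  · subst hxy
    rw [fieldOp_star_anticomm_self, inner_occVec_left, seaOcc_of_not_pos hx]
    exact occVec_self ∅
  · rw [fieldOp_star_anticomm e (Ne.symm hxy)]
    exact inner_zero_right _

theorem normalBilinear_eq_sub [DecidableEq X] (e : X → ℝ) (x y : X) :
    normalBilinear e x y =
      star (fieldOp e x) * fieldOp e y - (if x = y then seaOcc e x else 0) • 1 := by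
  rw [normalBilinear, inner_occVec_empty_star_fieldOp_mul]

theorem star_normalBilinear (e : X → ℝ) (x y : X) :
    star (normalBilinear e x y) = normalBilinear e y x := by
  rw [normalBilinear, normalBilinear, star_sub, star_mul, star_star, star_smul, star_one,
    ← starRingEnd_apply, inner_conj_symm, ← ContinuousLinearMap.adjoint_inner_right]
  congr 4
  rw [← ContinuousLinearMap.star_eq_adjoint, star_mul, star_star]

theorem lie_mul_mul_of_anticomm {R : Type*} [Ring R] {a b c d : R} (hac : a * c + c * a = 0)
    (hbd : b * d + d * b = 0) :
    a * b * (c * d) - c * d * (a * b) = a * (b * c + c * b) * d - c * (d * a + a * d) * b := by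
  have h : a * c * (b * d) = c * a * (d * b) := by
    rw [eq_neg_of_add_eq_zero_left hac, eq_neg_of_add_eq_zero_left hbd, neg_mul_neg]
  calc a * b * (c * d) - c * d * (a * b)
      = a * (b * c + c * b) * d - c * (d * a + a * d) * b -
          (a * c * (b * d) - c * a * (d * b)) := by noncomm_ring
    _ = a * (b * c + c * b) * d - c * (d * a + a * d) * b := by rw [h, sub_self, sub_zero]

theorem normalBilinear_commutator_eq (e : X → ℝ) (x y z w : X) :
    normalBilinear e x y * normalBilinear e z w - normalBilinear e z w * normalBilinear e x y =
      star (fieldOp e x) * (fieldOp e y * star (fieldOp e z) + star (fieldOp e z) * fieldOp e y) *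
        fieldOp e w -
      star (fieldOp e z) * (fieldOp e w * star (fieldOp e x) + star (fieldOp e x) * fieldOp e w) *
        fieldOp e y := by
  rw [← lie_mul_mul_of_anticomm (star_fieldOp_anticomm e x z) (fieldOp_anticomm e y w),
    normalBilinear, normalBilinear]
  simp only [sub_mul, mul_sub, smul_mul_assoc, mul_smul_comm, one_mul, mul_one, smul_sub]
  rw [smul_comm ⟪occVec ∅, (star (fieldOp e x) * fieldOp e y) (occVec ∅)⟫_ℂ]
  abel

theorem normalBilinear_commutator [DecidableEq X] (e : X → ℝ) (x y z w : X) :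
    normalBilinear e x y * normalBilinear e z w - normalBilinear e z w * normalBilinear e x y =
      (if y = z then normalBilinear e x w else 0) - (if x = w then normalBilinear e z y else 0) +
        (if y = z ∧ x = w then seaOcc e x - seaOcc e z else 0) • 1 := by
  rw [normalBilinear_commutator_eq]
  by_cases hyz : y = z <;> by_cases hxw : x = w
  · subst hyz hxw
    simp only [fieldOp_star_anticomm_self, normalBilinear_eq_sub, if_true, and_self, mul_one,
      sub_smul]
    abel
  · subst hyz
    simp [fieldOp_star_anticomm_self, fieldOp_star_anticomm e (Ne.symm hxw), normalBilinear_eq_sub,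
      hxw]
  · subst hxw
    simp [fieldOp_star_anticomm_self, fieldOp_star_anticomm e hyz, normalBilinear_eq_sub,
      Ne.symm hyz, hyz]
  · simp [fieldOp_star_anticomm e hyz, fieldOp_star_anticomm e (Ne.symm hxw), hyz, hxw]

theorem normalBilinear_of_not_pos (hx : ¬0 < e x) (y : X) :
    normalBilinear e x y = -(fieldOp e y * annihilate x) := by
  classical
  have hsx : star (fieldOp e x) = annihilate x := by rw [fieldOp_of_not_pos hx, star_star]
  rw [normalBilinear_eq_sub, seaOcc_of_not_pos hx, ← hsx]
  split_ifs with hxy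
  · rw [← hxy, one_smul, ← fieldOp_star_anticomm_self e x, sub_add_cancel_right]
  · rw [zero_smul, sub_zero]
    exact eq_neg_of_add_eq_zero_right (fieldOp_star_anticomm e (Ne.symm hxy))

theorem normalBilinear_of_pos (hx : 0 < e x) (hy : 0 < e y) :
    normalBilinear e x y = star (annihilate x) * annihilate y := by
  classical
  rw [normalBilinear_eq_sub, seaOcc_of_pos hx, ite_self, zero_smul, sub_zero, fieldOp_of_pos hx,
    fieldOp_of_pos hy]

theorem normalBilinear_occVec_eq_zero {S : Finset X} (hx : x ∉ S) (hy : y ∉ S)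
    (h : ¬(e y ≤ 0 ∧ 0 < e x)) : normalBilinear e x y (occVec S) = 0 := by
  by_cases hex : 0 < e x
  · have hey : 0 < e y := not_le.mp fun h' => h ⟨h', hex⟩
    rw [normalBilinear_of_pos hex hey]
    change star (annihilate x) (annihilate y (occVec S)) = 0
    rw [annihilate_occVec_of_notMem hy, map_zero]
  · rw [normalBilinear_of_not_pos hex]
    change -(fieldOp e y (annihilate x (occVec S))) = 0
    rw [annihilate_occVec_of_notMem hx, map_zero, neg_zero]

end DiracSea

section ExcitationEnergy

variable {X : Type} {e : X → ℝ} {t : ℝ} {φ : FockSpace X}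

/-- The energy of a set of excitations of the Dirac sea: particles and holes both count with the
absolute value of their one-particle energy. -/
def excitationEnergy (e : X → ℝ) (S : Finset X) : ℝ := ∑ x ∈ S, |e x|

/-- The span of the occupation-number basis vectors of excitation energy `t`. -/
noncomputable def energySpace (e : X → ℝ) (t : ℝ) : Submodule ℂ (FockSpace X) :=
  Submodule.span ℂ (occVec '' {S | excitationEnergy e S = t})

theorem excitationEnergy_nonneg (e : X → ℝ) (S : Finset X) : 0 ≤ excitationEnergy e S :=
  Finset.sum_nonneg fun _ _ => abs_nonneg _

theorem abs_le_excitationEnergy (e : X → ℝ) {S : Finset X} {x : X} (hx : x ∈ S) :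
    |e x| ≤ excitationEnergy e S :=
  Finset.single_le_sum (f := fun x => |e x|) (fun _ _ => abs_nonneg _) hx

theorem excitationEnergy_cons (e : X → ℝ) {S : Finset X} {x : X} (hx : x ∉ S) :
    excitationEnergy e (S.cons x hx) = |e x| + excitationEnergy e S :=
  Finset.sum_cons hx

theorem energySpace_le (e : X → ℝ) (t : ℝ) :
    energySpace e t ≤ Submodule.span ℂ (Set.range occVec) :=
  Submodule.span_mono (Set.image_subset_range _ _)

theorem occVec_mem_energySpace (e : X → ℝ) (S : Finset X) :
    occVec S ∈ energySpace e (excitationEnergy e S) :=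
  Submodule.subset_span ⟨S, rfl, rfl⟩

theorem annihilate_mem_energySpace (x : X) (hφ : φ ∈ energySpace e t) :
    annihilate x φ ∈ energySpace e (t - |e x|) :=
  annihilate_mem_span_occVec (fun S hx hS => by
    rw [Set.mem_ofPred_eq, excitationEnergy_cons] at hS
    exact eq_sub_of_add_eq' hS) hφ

theorem star_annihilate_mem_energySpace (x : X) (hφ : φ ∈ energySpace e t) :
    star (annihilate x) φ ∈ energySpace e (t + |e x|) :=
  adjoint_annihilate_mem_span_occVec (fun S hx hS => by
    rw [Set.mem_ofPred_eq, excitationEnergy_cons, hS, add_comm]) hφ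

theorem fieldOp_mem_energySpace (x : X) (hφ : φ ∈ energySpace e t) :
    fieldOp e x φ ∈ energySpace e (t - e x) := by
  by_cases hx : 0 < e x
  · rw [fieldOp_of_pos hx, ← abs_of_pos hx]
    exact annihilate_mem_energySpace x hφ
  · rw [fieldOp_of_not_pos hx, sub_eq_add_neg, ← abs_of_nonpos (not_lt.mp hx)]
    exact star_annihilate_mem_energySpace x hφ

theorem star_fieldOp_mem_energySpace (x : X) (hφ : φ ∈ energySpace e t) :
    star (fieldOp e x) φ ∈ energySpace e (t + e x) := by
  by_cases hx : 0 < e x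
  · rw [fieldOp_of_pos hx, ← abs_of_pos hx]
    exact star_annihilate_mem_energySpace x hφ
  · rw [fieldOp_of_not_pos hx, star_star, ← sub_neg_eq_add, ← abs_of_nonpos (not_lt.mp hx)]
    exact annihilate_mem_energySpace x hφ

theorem normalBilinear_mem_energySpace (x y : X) (hφ : φ ∈ energySpace e t) :
    normalBilinear e x y φ ∈ energySpace e (t - e y + e x) := by
  classical
  have hmul := star_fieldOp_mem_energySpace x (fieldOp_mem_energySpace y hφ)
  rw [normalBilinear_eq_sub]
  split_ifs with hxy
  · subst hxy
    rw [sub_add_cancel] at hmul ⊢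
    exact Submodule.sub_mem _ hmul (Submodule.smul_mem _ _ hφ)
  · rwa [zero_smul, sub_zero]

theorem finite_excitationEnergy_le (he : ∀ E : ℝ, {x | |e x| ≤ E}.Finite) (R : ℝ) :
    {S | excitationEnergy e S ≤ R}.Finite :=
  (he R).toFinset.powerset.finite_toSet.subset fun _ hS =>
    Finset.mem_coe.mpr <| Finset.mem_powerset.mpr fun _ hx =>
      (he R).mem_toFinset.mpr ((abs_le_excitationEnergy e hx).trans hS)

variable (he : ∀ E : ℝ, {x | |e x| ≤ E}.Finite)

/-- The orthogonal projection onto the vectors of excitation energy at most `R`. -/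
noncomputable def energyCutoff (R : ℝ) : FockSpace X →L[ℂ] FockSpace X :=
  occProj (finite_excitationEnergy_le he R).toFinset

theorem energyCutoff_of_le {R : ℝ} (ht : t ≤ R) (hφ : φ ∈ energySpace e t) :
    energyCutoff he R φ = φ := by
  refine LinearMap.eqOn_span (f := (energyCutoff he R : FockSpace X →ₗ[ℂ] FockSpace X))
    (g := LinearMap.id) (Set.forall_mem_image.mpr fun S hS => ?_) hφ
  exact occProj_occVec_of_mem ((Set.Finite.mem_toFinset _).mpr (hS.trans_le ht))

theorem energyCutoff_of_lt {R : ℝ} (ht : R < t) (hφ : φ ∈ energySpace e t) :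
    energyCutoff he R φ = 0 := by
  refine LinearMap.eqOn_span (f := (energyCutoff he R : FockSpace X →ₗ[ℂ] FockSpace X))
    (g := 0) (Set.forall_mem_image.mpr fun S hS => ?_) hφ
  exact occProj_occVec_of_notMem fun hS' =>
    ((Set.Finite.mem_toFinset _).mp hS').not_gt (ht.trans_eq hS.symm)

theorem tendsto_energyCutoff (φ : FockSpace X) :
    Filter.Tendsto (fun R => energyCutoff he R φ) Filter.atTop (nhds φ) := by
  refine (tendsto_occProj φ).comp (Filter.tendsto_atTop_finset_of_monotone ?_ fun S => ?_)
  · exact fun R R' hR => Set.Finite.toFinset_mono fun S hS => le_trans hS hR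
  · exact ⟨excitationEnergy e S, by simp⟩

theorem finite_normalBilinear_ne_zero (he : ∀ E : ℝ, {x | |e x| ≤ E}.Finite) (c : ℝ)
    (hφ : φ ∈ Submodule.span ℂ (Set.range occVec)) :
    {q : X × X | e q.1 = e q.2 + c ∧ normalBilinear e q.1 q.2 φ ≠ 0}.Finite := by
  induction hφ using Submodule.span_induction with
  | mem φ h =>
    obtain ⟨S, rfl⟩ := h
    have hfin := he (excitationEnergy e S + |c|)
    refine (hfin.prod hfin).subset fun ⟨x, y⟩ ⟨hxy, hne⟩ => ?_
    have hS := excitationEnergy_nonneg e S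
    have hc := abs_le.mp (le_refl |c|)
    simp only [Set.mem_prod, Set.mem_ofPred_eq, abs_le] at hxy ⊢
    by_cases hx : x ∈ S
    · have hex := abs_le.mp (abs_le_excitationEnergy e hx)
      constructor <;> constructor <;> linarith
    by_cases hy : y ∈ S
    · have hey := abs_le.mp (abs_le_excitationEnergy e hy)
      constructor <;> constructor <;> linarith
    have hpair : e y ≤ 0 ∧ 0 < e x := not_not.mp (mt (normalBilinear_occVec_eq_zero hx hy) hne)
    constructor <;> constructor <;> linarith
  | zero => simp
  | add φ χ _ _ hφ hχ =>
    refine (hφ.union hχ).subset fun q ⟨hq, hne⟩ => ?_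
    rw [map_add] at hne
    exact (em (normalBilinear e q.1 q.2 φ = 0)).symm.imp (fun h => ⟨hq, h⟩)
      fun h => ⟨hq, fun h' => hne (by rw [h, h', add_zero])⟩
  | smul a φ _ hφ =>
    refine hφ.subset fun q ⟨hq, hne⟩ => ⟨hq, fun h => hne ?_⟩
    rw [map_smul, h, smul_zero]

end ExcitationEnergy

section FiniteSums

open Filter

variable {I E : Type*} [AddCommGroup E] [TopologicalSpace E] [T2Space E] {f : I → E} {v : E}

theorem eventually_sum_eq_of_hasSum (hf : HasSum f v) (hfin : f.support.Finite) :
    ∀ᶠ s in atTop, ∑ i ∈ s, f i = v := by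
  filter_upwards [eventually_ge_atTop hfin.toFinset] with s hs
  refine (hasSum_sum_of_ne_finset_zero fun i hi => ?_).unique hf
  exact Function.notMem_support.mp fun h => hi (hs (hfin.mem_toFinset.mpr h))

theorem eventually_sum_sum_eq_of_hasSum {X : Type*} {f : X × X → E} (hf : HasSum f v)
    (hfin : f.support.Finite) : ∀ᶠ G : Finset X in atTop, ∑ x ∈ G, ∑ y ∈ G, f (x, y) = v := by
  simp only [← Finset.sum_product]
  have hdiag : Tendsto (fun G : Finset X => G ×ˢ G) atTop atTop :=
    tendsto_finsetProd_atTop.comp tendsto_atTop_diagonal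
  exact hdiag.eventually (eventually_sum_eq_of_hasSum hf hfin)

theorem mem_of_hasSum_of_finite_support {R : Type*} [Ring R] [Module R E] {K : Submodule R E}
    (hf : HasSum f v) (hfin : f.support.Finite) (h : ∀ i, f i ∈ K) : v ∈ K := by
  obtain ⟨s, hs⟩ := (eventually_sum_eq_of_hasSum hf hfin).exists
  exact hs ▸ Submodule.sum_mem K fun i _ => h i

end FiniteSums

section CentralExtension

variable {X : Type}

/-- The second quantization of the matrix `U`, restricted to the finitely many states of `G`. -/
noncomputable def finiteQuant (e : X → ℝ) (G : Finset X) (U : Matrix X X ℂ) :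
    FockSpace X →L[ℂ] FockSpace X :=
  ∑ x ∈ G, ∑ y ∈ G, U x y • normalBilinear e x y

theorem commutator_finiteQuant (e : X → ℝ) (G : Finset X) (V : Matrix X X ℂ)
    (T : FockSpace X →L[ℂ] FockSpace X) :
    T * finiteQuant e G V - finiteQuant e G V * T =
      ∑ x ∈ G, ∑ y ∈ G, V x y • (T * normalBilinear e x y - normalBilinear e x y * T) := by
  simp only [finiteQuant, Finset.sum_mul, Finset.mul_sum, smul_mul_assoc, mul_smul_comm,
    smul_sub, Finset.sum_sub_distrib]

theorem normalBilinear_commutator_finiteQuant (e : X → ℝ) {G : Finset X} (V : Matrix X X ℂ)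
    {z w : X} (hz : z ∈ G) (hw : w ∈ G) :
    normalBilinear e z w * finiteQuant e G V - finiteQuant e G V * normalBilinear e z w =
      ∑ y ∈ G, V w y • normalBilinear e z y - ∑ x ∈ G, V x z • normalBilinear e x w +
        (V w z * (seaOcc e z - seaOcc e w)) • 1 := by
  classical
  simp only [commutator_finiteQuant, normalBilinear_commutator, smul_add, smul_ite, smul_sub,
    smul_zero, ite_smul, zero_smul, Finset.sum_add_distrib, Finset.sum_sub_distrib, ite_and,
    Finset.sum_ite_eq, Finset.sum_ite_irrel, Finset.sum_const_zero, if_pos hz, if_pos hw,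
    smul_smul]

theorem finiteQuant_commutator (e : X → ℝ) (G : Finset X) (U V : Matrix X X ℂ) :
    finiteQuant e G U * finiteQuant e G V - finiteQuant e G V * finiteQuant e G U =
      finiteQuant e G (fun x w => ∑ y ∈ G, (U x y * V y w - V x y * U y w)) +
        (∑ x ∈ G, ∑ y ∈ G, U x y * V y x * (seaOcc e x - seaOcc e y)) • 1 := by
  have hcomm : finiteQuant e G U * finiteQuant e G V - finiteQuant e G V * finiteQuant e G U =
      ∑ z ∈ G, ∑ w ∈ G, U z w • (normalBilinear e z w * finiteQuant e G V -
        finiteQuant e G V * normalBilinear e z w) := by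
    rw [← neg_sub, commutator_finiteQuant]
    simp only [← Finset.sum_neg_distrib, ← smul_neg, neg_sub]
  have hUV : ∑ z ∈ G, ∑ w ∈ G, ∑ y ∈ G, (U z w * V w y) • normalBilinear e z y =
      ∑ x ∈ G, ∑ w ∈ G, ∑ y ∈ G, (U x y * V y w) • normalBilinear e x w :=
    Finset.sum_congr rfl fun z _ => Finset.sum_comm
  have hVU : ∑ z ∈ G, ∑ w ∈ G, ∑ x ∈ G, (U z w * V x z) • normalBilinear e x w =
      ∑ x ∈ G, ∑ w ∈ G, ∑ y ∈ G, (V x y * U y w) • normalBilinear e x w := by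
    rw [Finset.sum_congr rfl fun z _ => Finset.sum_comm, Finset.sum_comm]
    simp only [mul_comm (U _ _)]
    exact Finset.sum_congr rfl fun x _ => Finset.sum_comm
  rw [hcomm, Finset.sum_congr rfl fun z hz => Finset.sum_congr rfl fun w hw => congrArg _
    (normalBilinear_commutator_finiteQuant e V hz hw)]
  simp only [finiteQuant, smul_add, smul_sub, Finset.smul_sum, smul_smul, Finset.sum_add_distrib,
    Finset.sum_sub_distrib, Finset.sum_smul, sub_smul, hUV, hVU, mul_assoc]

end CentralExtension

section SecondQuantization

open Filter

variable {X : Type} {e : X → ℝ} {c c' t : ℝ} {U V C : Matrix X X ℂ} {φ : FockSpace X}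

/-- The one-particle operator `U` raises the one-particle energy by exactly `c`. -/
def ShiftsBy (e : X → ℝ) (c : ℝ) (U : Matrix X X ℂ) : Prop :=
  ∀ x y, U x y ≠ 0 → e x = e y + c

/-- The second quantization of the one-particle operator `U`, normal ordered with respect to the
Dirac sea of `e`, on the space of all vectors on which its series converges unconditionally. -/
noncomputable def secondQuant (e : X → ℝ) (U : Matrix X X ℂ) : FockSpace X →ₗ.[ℂ] FockSpace X :=
  seriesPMap fun q : X × X => U q.1 q.2 • normalBilinear e q.1 q.2

theorem ShiftsBy.conjTranspose (hU : ShiftsBy e c U) : ShiftsBy e (-c) U.conjTranspose :=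
  fun x y h => by linarith [hU y x fun h' => h (by rw [Matrix.conjTranspose_apply, h', star_zero])]

theorem ShiftsBy.smul (hU : ShiftsBy e c U) (a : ℂ) : ShiftsBy e c (a • U) :=
  fun x y h => hU x y (right_ne_zero_of_mul h)

theorem ShiftsBy.sum {K : Type*} {s : Finset K} {U : K → Matrix X X ℂ}
    (hU : ∀ k ∈ s, ShiftsBy e c (U k)) : ShiftsBy e c (∑ k ∈ s, U k) := fun x y h => by
  rw [Matrix.sum_apply] at h
  obtain ⟨k, hk, hne⟩ := Finset.exists_ne_zero_of_sum_ne_zero h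
  exact hU k hk x y hne

theorem ShiftsBy.commutator_eq_zero (hU : ShiftsBy e c U) (hV : ShiftsBy e c' V) {x w : X}
    (h : e x ≠ e w + (c + c')) (y : X) : U x y * V y w - V x y * U y w = 0 := by
  have hUV : U x y * V y w = 0 := by
    by_contra hne
    exact h (by linarith [hU _ _ (left_ne_zero_of_mul hne), hV _ _ (right_ne_zero_of_mul hne)])
  have hVU : V x y * U y w = 0 := by
    by_contra hne
    exact h (by linarith [hV _ _ (left_ne_zero_of_mul hne), hU _ _ (right_ne_zero_of_mul hne)])
  rw [hUV, hVU, sub_zero]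

theorem ShiftsBy.of_hasSum_commutator (hU : ShiftsBy e c U) (hV : ShiftsBy e c' V)
    (hC : ∀ x w, HasSum (fun y => U x y * V y w - V x y * U y w) (C x w)) :
    ShiftsBy e (c + c') C := fun x w hne => by
  by_contra h
  have hzero := hC x w
  simp only [hU.commutator_eq_zero hV h] at hzero
  exact hne (hzero.unique hasSum_zero)

theorem mem_graph_secondQuant {v : FockSpace X} : (φ, v) ∈ (secondQuant e U).graph ↔
    HasSum (fun q : X × X => U q.1 q.2 • normalBilinear e q.1 q.2 φ) v :=
  mem_graph_seriesPMap

theorem act_secondQuant_zero (e : X → ℝ) (φ : FockSpace X) : act (secondQuant e 0) φ = 0 := by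
  refine act_eq_of_mem_graph (mem_graph_secondQuant.mpr ?_)
  simpa only [Matrix.zero_apply, zero_smul] using hasSum_zero

theorem isFormalAdjoint_secondQuant (e : X → ℝ) (U : Matrix X X ℂ) :
    (secondQuant e U.conjTranspose).IsFormalAdjoint (secondQuant e U) := by
  have hadj : secondQuant e U.conjTranspose = seriesPMap fun q : X × X =>
      (U q.1 q.2 • normalBilinear e q.1 q.2).adjoint := by
    refine seriesPMap_congr fun φ v => ?_
    rw [← (Equiv.prodComm X X).hasSum_iff]
    refine iff_of_eq (congrArg (HasSum · v) (funext fun q => ?_))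
    rw [← ContinuousLinearMap.star_eq_adjoint, star_smul, star_normalBilinear]
    rfl
  rw [hadj]
  exact isFormalAdjoint_seriesPMap_adjoint _

theorem secondQuant_vacuum (hU : ShiftsBy e c U) (hc : c ≤ 0) :
    (occVec ∅, 0) ∈ (secondQuant e U).graph := by
  refine mem_graph_secondQuant.mpr ?_
  convert hasSum_zero with q
  refine smul_eq_zero.mpr (or_iff_not_imp_left.mpr fun h => ?_)
  refine normalBilinear_occVec_eq_zero (Finset.notMem_empty _) (Finset.notMem_empty _) ?_
  rintro ⟨h1, h2⟩
  linarith [hU _ _ h]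

section FiniteExcitations

variable (he : ∀ E : ℝ, {x | |e x| ≤ E}.Finite)
include he

theorem finite_support_secondQuant (hU : ShiftsBy e c U)
    (hφ : φ ∈ Submodule.span ℂ (Set.range occVec)) :
    (fun q : X × X => U q.1 q.2 • normalBilinear e q.1 q.2 φ).support.Finite :=
  (finite_normalBilinear_ne_zero he c hφ).subset fun _ hq =>
    ⟨hU _ _ (left_ne_zero_of_smul hq), right_ne_zero_of_smul hq⟩

theorem span_occVec_le_domain_secondQuant (hU : ShiftsBy e c U) :
    Submodule.span ℂ (Set.range occVec) ≤ (secondQuant e U).domain :=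
  fun _ hφ => summable_of_hasFiniteSupport (finite_support_secondQuant he hU hφ)

theorem hasSum_act_secondQuant (hU : ShiftsBy e c U)
    (hφ : φ ∈ Submodule.span ℂ (Set.range occVec)) :
    HasSum (fun q : X × X => U q.1 q.2 • normalBilinear e q.1 q.2 φ)
      (act (secondQuant e U) φ) := by
  have h := (secondQuant e U).mem_graph ⟨φ, span_occVec_le_domain_secondQuant he hU hφ⟩
  rw [act_eq_of_mem_graph h]
  exact mem_graph_secondQuant.mp h

theorem act_secondQuant_mem_energySpace (hU : ShiftsBy e c U) (hφ : φ ∈ energySpace e t) :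
    act (secondQuant e U) φ ∈ energySpace e (t + c) := by
  have hφ' := energySpace_le e t hφ
  refine mem_of_hasSum_of_finite_support (hasSum_act_secondQuant he hU hφ')
    (finite_support_secondQuant he hU hφ') fun q => ?_
  by_cases hq : U q.1 q.2 = 0
  · rw [hq, zero_smul]
    exact Submodule.zero_mem _
  · have h := normalBilinear_mem_energySpace q.1 q.2 hφ
    rw [hU _ _ hq, ← add_assoc, sub_add_cancel] at h
    exact Submodule.smul_mem _ _ h

theorem act_secondQuant_mem_span_occVec (hU : ShiftsBy e c U)
    (hφ : φ ∈ Submodule.span ℂ (Set.range occVec)) :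
    act (secondQuant e U) φ ∈ Submodule.span ℂ (Set.range occVec) := by
  refine mem_of_hasSum_of_finite_support (hasSum_act_secondQuant he hU hφ)
    (finite_support_secondQuant he hU hφ) fun q => Submodule.smul_mem _ _ ?_
  rw [← Set.image_univ] at hφ ⊢
  refine map_mem_span_occVec (fun S _ => Set.image_univ ▸ ?_) hφ
  exact energySpace_le e _ (normalBilinear_mem_energySpace _ _ (occVec_mem_energySpace e S))

theorem eventually_finiteQuant_eq_act (hU : ShiftsBy e c U)
    (hφ : φ ∈ Submodule.span ℂ (Set.range occVec)) :
    ∀ᶠ G in atTop, finiteQuant e G U φ = act (secondQuant e U) φ := by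
  filter_upwards [eventually_sum_sum_eq_of_hasSum (hasSum_act_secondQuant he hU hφ)
    (finite_support_secondQuant he hU hφ)] with G hG
  simpa only [finiteQuant, sum_apply, smul_apply] using hG

theorem act_secondQuant_sum_smul {K : Type*} {s : Finset K} (a : K → ℂ) {U : K → Matrix X X ℂ}
    (hU : ∀ k ∈ s, ShiftsBy e c (U k)) (hφ : φ ∈ Submodule.span ℂ (Set.range occVec)) :
    act (secondQuant e (∑ k ∈ s, a k • U k)) φ = ∑ k ∈ s, a k • act (secondQuant e (U k)) φ := by
  refine (hasSum_act_secondQuant he (ShiftsBy.sum fun k hk => (hU k hk).smul (a k)) hφ).unique ?_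
  convert hasSum_sum fun k hk => (hasSum_act_secondQuant he (hU k hk) hφ).const_smul (a k)
    using 2 with q
  simp only [Matrix.sum_apply, Matrix.smul_apply, Finset.sum_smul, smul_assoc]

theorem finite_commutator_support (hU : ShiftsBy e c U) (hV : ShiftsBy e c' V) (x w : X) :
    (fun y => U x y * V y w - V x y * U y w).support.Finite := by
  refine (he (|e w| + |c| + |c'|)).subset fun y hy => ?_
  have hor : e y = e w + c' ∨ e y = e w + c := by
    by_contra! h
    have hV' : V y w = 0 := not_not.mp fun hne => h.1 (hV _ _ hne)
    have hU' : U y w = 0 := not_not.mp fun hne => h.2 (hU _ _ hne)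
    exact hy (by simp only [hV', hU', mul_zero, sub_zero])
  have hc := abs_nonneg c
  have hc' := abs_nonneg c'
  rcases hor with h | h <;> rw [Set.mem_ofPred_eq, h] <;> refine (abs_add_le _ _).trans ?_ <;>
    linarith

theorem finite_schwinger_support (hU : ShiftsBy e c U) (V : Matrix X X ℂ) :
    (fun q : X × X => U q.1 q.2 * V q.2 q.1 * (seaOcc e q.1 - seaOcc e q.2)).support.Finite := by
  refine ((he |c|).prod (he |c|)).subset fun ⟨x, y⟩ hq => ?_
  have hxy := hU x y (left_ne_zero_of_mul (left_ne_zero_of_mul hq))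
  have hc := abs_le.mp (le_refl |c|)
  have hocc : seaOcc e x ≠ seaOcc e y := sub_ne_zero.mp (right_ne_zero_of_mul hq)
  simp only [Set.mem_prod, Set.mem_ofPred_eq, abs_le]
  rcases lt_or_ge 0 (e x) with hx | hx <;> rcases lt_or_ge 0 (e y) with hy | hy
  · exact absurd (by rw [seaOcc_of_pos hx, seaOcc_of_pos hy]) hocc
  · constructor <;> constructor <;> linarith
  · constructor <;> constructor <;> linarith
  · exact absurd (by rw [seaOcc_of_not_pos hx.not_gt, seaOcc_of_not_pos hy.not_gt]) hocc

theorem eventually_finiteQuant_commutator_eq (hU : ShiftsBy e c U) (hV : ShiftsBy e c' V)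
    (hC : ∀ x w, HasSum (fun y => U x y * V y w - V x y * U y w) (C x w))
    (hφ : φ ∈ Submodule.span ℂ (Set.range occVec)) : ∀ᶠ G in atTop,
      finiteQuant e G (fun x w => ∑ y ∈ G, (U x y * V y w - V x y * U y w)) φ =
        finiteQuant e G C φ := by
  have hfin := finite_normalBilinear_ne_zero he (c + c') hφ
  filter_upwards [(Filter.eventually_all_finite hfin).mpr fun q _ =>
    eventually_sum_eq_of_hasSum (hC q.1 q.2) (finite_commutator_support he hU hV q.1 q.2)]
    with G hG
  simp only [finiteQuant, sum_apply, smul_apply]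
  refine Finset.sum_congr rfl fun x _ => Finset.sum_congr rfl fun w _ => ?_
  by_cases hN : normalBilinear e x w φ = 0
  · rw [hN, smul_zero, smul_zero]
  by_cases hxw : e x = e w + (c + c')
  · rw [hG (x, w) ⟨hxw, hN⟩]
  · rw [Finset.sum_eq_zero fun y _ => hU.commutator_eq_zero hV hxw y,
      not_not.mp (mt (hU.of_hasSum_commutator hV hC x w) hxw)]

theorem commAt_secondQuant (hU : ShiftsBy e c U) (hV : ShiftsBy e c' V)
    (hC : ∀ x w, HasSum (fun y => U x y * V y w - V x y * U y w) (C x w)) {κ : ℂ}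
    (hκ : HasSum (fun q : X × X => U q.1 q.2 * V q.2 q.1 * (seaOcc e q.1 - seaOcc e q.2)) κ)
    (hφ : φ ∈ Submodule.span ℂ (Set.range occVec)) :
    commAt (secondQuant e U) (secondQuant e V) φ = act (secondQuant e C) φ + κ • φ := by
  classical
  have hφU := act_secondQuant_mem_span_occVec he hU hφ
  have hφV := act_secondQuant_mem_span_occVec he hV hφ
  obtain ⟨G, hGU, hGV, hGUV, hGVU, hGC, hGC', hGκ⟩ :=
    ((eventually_finiteQuant_eq_act he hU hφ).and <|
      (eventually_finiteQuant_eq_act he hV hφ).and <|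
      (eventually_finiteQuant_eq_act he hU hφV).and <|
      (eventually_finiteQuant_eq_act he hV hφU).and <|
      (eventually_finiteQuant_eq_act he (hU.of_hasSum_commutator hV hC) hφ).and <|
      (eventually_finiteQuant_commutator_eq he hU hV hC hφ).and <|
      eventually_sum_sum_eq_of_hasSum hκ (finite_schwinger_support he hU V)).exists
  have hG := congrArg (· φ) (finiteQuant_commutator e G U V)
  rw [commAt, ← hGUV, ← hGVU, ← hGU, ← hGV, ← hGC, ← hGC', ← hGκ]
  exact hG

theorem energyCutoff_mem_graph (hU : ShiftsBy e c U) (R : ℝ) {p : FockSpace X × FockSpace X}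
    (hp : p ∈ ((secondQuant e U).domRestrict (Submodule.span ℂ (Set.range occVec))).graph) :
    (energyCutoff he R p.1, energyCutoff he (R + c) p.2) ∈
      ((secondQuant e U).domRestrict (Submodule.span ℂ (Set.range occVec))).graph := by
  rw [graph_domRestrict_span (span_occVec_le_domain_secondQuant he hU)] at hp ⊢
  induction hp using Submodule.span_induction with
  | mem p hp =>
    obtain ⟨hgraph, S, hS⟩ := hp
    obtain ⟨_, v⟩ := p
    subst hS
    have hφ := occVec_mem_energySpace e S
    have hv : v ∈ energySpace e (excitationEnergy e S + c) :=
      act_eq_of_mem_graph hgraph ▸ act_secondQuant_mem_energySpace he hU hφ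
    rcases le_or_gt (excitationEnergy e S) R with h | h
    · rw [energyCutoff_of_le he h hφ, energyCutoff_of_le he (by linarith) hv]
      exact Submodule.subset_span ⟨hgraph, S, rfl⟩
    · rw [energyCutoff_of_lt he h hφ, energyCutoff_of_lt he (by linarith) hv]
      exact Submodule.zero_mem _
  | zero =>
    simp only [Prod.fst_zero, Prod.snd_zero, map_zero]
    exact Submodule.zero_mem _
  | add p q _ _ hp hq => simpa using Submodule.add_mem _ hp hq
  | smul a p _ hp => simpa using Submodule.smul_mem _ a hp

-- `U` maps the vectors of energy at most `R` to vectors of energy at most `R + c` and commutes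
-- with the corresponding cutoffs.
theorem adjoint_secondQuant_le_closure (hU : ShiftsBy e c U) :
    ((secondQuant e U).domRestrict (Submodule.span ℂ (Set.range occVec))).adjoint ≤
      ((secondQuant e U.conjTranspose).domRestrict
        (Submodule.span ℂ (Set.range occVec))).closure := by
  have hformal := (isFormalAdjoint_secondQuant e U).symm
  exact adjoint_le_closure_of_truncation (l := atTop)
    (P := fun R => energyCutoff he (R + c)) (Q := energyCutoff he)
    (dense_domain_domRestrict dense_span_occVec (span_occVec_le_domain_secondQuant he hU))
    (fun x y => hformal ⟨x, x.2.2⟩ ⟨y, y.2.2⟩)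
    (fun R => isSymmetric_occProj _) (fun R => isSymmetric_occProj _)
    (fun x => (tendsto_energyCutoff he x).comp (tendsto_atTop_add_const_right _ c tendsto_id))
    (tendsto_energyCutoff he)
    (fun R x => ⟨occProj_mem_span _ _,
      span_occVec_le_domain_secondQuant he hU.conjTranspose (occProj_mem_span _ _)⟩)
    fun R p hp => energyCutoff_mem_graph he hU R hp

theorem isClosable_secondQuant (hU : ShiftsBy e c U) : (secondQuant e U).IsClosable :=
  isClosable_of_isFormalAdjoint (isFormalAdjoint_secondQuant e U)
    (dense_span_occVec.mono (span_occVec_le_domain_secondQuant he hU.conjTranspose))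

theorem adjoint_secondQuant_conjTranspose_le_closure (hU : ShiftsBy e c U) :
    ((secondQuant e U.conjTranspose).domRestrict
        (Submodule.span ℂ (Set.range occVec))).adjoint ≤
      ((secondQuant e U).domRestrict (Submodule.span ℂ (Set.range occVec))).closure := by
  simpa only [Matrix.conjTranspose_conjTranspose] using
    adjoint_secondQuant_le_closure he hU.conjTranspose

theorem hasCore_closure_secondQuant (hU : ShiftsBy e c U) :
    (secondQuant e U).closure.HasCore (Submodule.span ℂ (Set.range occVec)) :=
  hasCore_closure (isFormalAdjoint_secondQuant e U) dense_span_occVec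
    (span_occVec_le_domain_secondQuant he hU.conjTranspose)
    (span_occVec_le_domain_secondQuant he hU)
    (adjoint_secondQuant_conjTranspose_le_closure he hU)

theorem adjoint_closure_secondQuant (hU : ShiftsBy e c U) :
    (secondQuant e U).closure.adjoint = (secondQuant e U.conjTranspose).closure :=
  adjoint_closure_eq_closure (isFormalAdjoint_secondQuant e U) dense_span_occVec
    dense_span_occVec (span_occVec_le_domain_secondQuant he hU.conjTranspose)
    (span_occVec_le_domain_secondQuant he hU)
    (adjoint_secondQuant_conjTranspose_le_closure he hU) (adjoint_secondQuant_le_closure he hU)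

end FiniteExcitations

end SecondQuantization

section NodalMomenta

variable {L a : ℝ} {s : ℤˣ} {M : ℕ} {p q k k' : ℤˣ → ℝ}

theorem neg_unit_ne_self (s : ℤˣ) : -s ≠ s :=
  Int.units_ne_iff_eq_neg.mpr rfl

theorem forall_units_iff (s : ℤˣ) {P : ℤˣ → Prop} : (∀ t, P t) ↔ P s ∧ P (-s) := by
  refine ⟨fun h => ⟨h s, h (-s)⟩, fun ⟨hs, hneg⟩ t => ?_⟩
  rcases eq_or_ne t s with rfl | ht
  · exact hs
  · exact Int.units_ne_iff_eq_neg.mp ht ▸ hneg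

/-- The reciprocal vector `2π e_{-s}/a`, modulo which momenta are conserved on the arcs `s`. -/
noncomputable def umklappVec (a : ℝ) (s : ℤˣ) : ℤˣ → ℝ := (2 * Real.pi / a) • unitVec (-s)

theorem umklappVec_apply_self (a : ℝ) (s : ℤˣ) : umklappVec a s s = 0 := by
  simp [umklappVec, unitVec, (neg_unit_ne_self s).symm]

theorem umklappVec_apply_neg (a : ℝ) (s : ℤˣ) : umklappVec a s (-s) = 2 * Real.pi / a := by
  simp [umklappVec, unitVec]

theorem zsmul_umklappVec (a : ℝ) (s : ℤˣ) (n : ℤ) :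
    n • umklappVec a s = (2 * Real.pi * n / a) • unitVec (-s) := by
  rw [umklappVec, ← Int.cast_smul_eq_zsmul ℝ, smul_smul]
  congr 1
  ring

theorem umklappVec_ne_zero (ha : a ≠ 0) (s : ℤˣ) : umklappVec a s ≠ 0 := fun h =>
  div_ne_zero Real.two_pi_pos.ne' ha (umklappVec_apply_neg a s ▸ congrFun h (-s))

theorem zsmul_umklappVec_injective (ha : a ≠ 0) (s : ℤˣ) :
    Function.Injective fun n : ℤ => n • umklappVec a s :=
  smul_left_injective ℤ (umklappVec_ne_zero ha s)

theorem modEq_umklappVec_iff :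
    p ≡ q [PMOD umklappVec a s] ↔ p s = q s ∧ p (-s) ≡ q (-s) [PMOD 2 * Real.pi / a] := by
  simp only [AddCommGroup.modEq_iff_eq_add_zsmul, funext_iff, forall_units_iff s, Pi.add_apply,
    Pi.smul_apply, umklappVec_apply_self, umklappVec_apply_neg, smul_zero, add_zero,
    exists_and_left, eq_comm (a := q s)]

open Classical in
theorem umklappDelta_eq_ite (ha : a ≠ 0) (s : ℤˣ) (q : ℤˣ → ℝ) :
    umklappDelta a s q = if q ≡ 0 [PMOD umklappVec a s] then 1 else 0 := by
  simp only [umklappDelta, ← zsmul_umklappVec, AddCommGroup.modEq_zero_iff_eq_zsmul]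
  split_ifs with h
  · obtain ⟨n, rfl⟩ := h
    simpa only [(zsmul_umklappVec_injective ha s).eq_iff, eq_comm (a := n)] using
      tsum_ite_eq n fun _ => (1 : ℂ)
  · exact (tsum_congr fun n => if_neg (not_exists.mp h n)).trans tsum_zero

theorem eq_of_modEq_umklappVec (ha : 0 < a) (hk : k ∈ fermionMomenta L a s)
    (hk' : k' ∈ fermionMomenta L a s) (h : k ≡ k' [PMOD umklappVec a s]) : k = k' := by
  obtain ⟨hs, hneg⟩ := modEq_umklappVec_iff.mp h
  have hperiod : 0 < 2 * Real.pi / a := by positivity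
  have hwindow : -(Real.pi / a) + 2 * Real.pi / a = Real.pi / a := by ring
  have hmod {k : ℤˣ → ℝ} (hk : k ∈ fermionMomenta L a s) :
      toIcoMod hperiod (-(Real.pi / a)) (k (-s)) = k (-s) :=
    (toIcoMod_eq_self hperiod).mpr (by rw [hwindow]; exact hk.2)
  refine funext ((forall_units_iff s).mpr ⟨hs, ?_⟩)
  rw [← hmod hk, ← hmod hk', hneg.toIcoMod_eq_toIcoMod]

/-- The momentum whose component along `e_s` has quantum number `m` and whose component along
`e_{-s}` has quantum number `j`; a component with quantum number `n` equals `(2π/L)(n + 1/2)`. -/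
noncomputable def momentumOfLevels (L : ℝ) (s : ℤˣ) (m j : ℤ) : ℤˣ → ℝ := fun t =>
  2 * Real.pi / L * ((if t = s then m else j : ℤ) + 1 / 2)

theorem momentumOfLevels_apply_self (L : ℝ) (s : ℤˣ) (m j : ℤ) :
    momentumOfLevels L s m j s = 2 * Real.pi / L * (m + 1 / 2) := by
  rw [momentumOfLevels, if_pos rfl]

theorem momentumOfLevels_apply_neg (L : ℝ) (s : ℤˣ) (m j : ℤ) :
    momentumOfLevels L s m j (-s) = 2 * Real.pi / L * (j + 1 / 2) := by
  rw [momentumOfLevels, if_neg (neg_unit_ne_self s)]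

theorem exists_momentumOfLevels (s : ℤˣ) (hk : ∀ t, ∃ m : ℤ, k t = 2 * Real.pi / L * (m + 1 / 2)) :
    ∃ m j, momentumOfLevels L s m j = k := by
  obtain ⟨m, hm⟩ := hk s
  obtain ⟨j, hj⟩ := hk (-s)
  refine ⟨m, j, funext ((forall_units_iff s).mpr ⟨?_, ?_⟩)⟩
  · rw [momentumOfLevels_apply_self, hm]
  · rw [momentumOfLevels_apply_neg, hj]

theorem momentumOfLevels_inj (hL : L ≠ 0) {m m' j j' : ℤ}
    (h : momentumOfLevels L s m j = momentumOfLevels L s m' j') : m = m' ∧ j = j' := by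
  have hstep : 2 * Real.pi / L ≠ 0 := div_ne_zero Real.two_pi_pos.ne' hL
  have hs := congrFun h s
  have hneg := congrFun h (-s)
  simp only [momentumOfLevels_apply_self, momentumOfLevels_apply_neg, mul_right_inj' hstep,
    add_left_inj, Int.cast_inj] at hs hneg
  exact ⟨hs, hneg⟩

theorem momentumOfLevels_mem_iff (ha : 0 < a) (hM0 : 0 < M) (hM : L = M * a) (s : ℤˣ)
    (m j : ℤ) :
    momentumOfLevels L s m j ∈ fermionMomenta L a s ↔
      j ∈ Finset.Ico (-((M + 1) / 2) : ℤ) (M / 2) := by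
  have : (0 : ℝ) < M := by exact_mod_cast hM0
  have hstep : 0 < Real.pi / (M * a) := by positivity
  have hedge : Real.pi / a = Real.pi / (M * a) * M := by field_simp
  have hlevel : 2 * Real.pi / (M * a) * (j + 1 / 2) = Real.pi / (M * a) * (2 * j + 1) := by ring
  have hleft : -(M : ℝ) ≤ 2 * j + 1 ↔ -(M : ℤ) ≤ 2 * j + 1 := by exact_mod_cast Iff.rfl
  have hright : 2 * (j : ℝ) + 1 < M ↔ 2 * j + 1 < (M : ℤ) := by exact_mod_cast Iff.rfl
  have hwindow : momentumOfLevels L s m j ∈ fermionMomenta L a s ↔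
      -(M : ℤ) ≤ 2 * j + 1 ∧ 2 * j + 1 < (M : ℤ) := by
    rw [fermionMomenta, Set.mem_ofPred_eq, momentumOfLevels_apply_neg, hM, hlevel, hedge,
      ← mul_neg, mul_le_mul_iff_right₀ hstep, mul_lt_mul_iff_right₀ hstep, hleft, hright]
    exact and_iff_right fun t => ⟨_, rfl⟩
  rw [hwindow, Finset.mem_Ico]
  omega

theorem exists_modEq_umklappVec (ha : 0 < a) (hM0 : 0 < M) (hM : L = M * a)
    (hk : k ∈ fermionMomenta L a s) (hp : p ∈ bosonMomenta L) :
    ∃ k' ∈ fermionMomenta L a s, k + p ≡ k' [PMOD umklappVec a s] := by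
  obtain ⟨m, j, rfl⟩ := exists_momentumOfLevels s hk.1
  obtain ⟨l, hl⟩ := hp s
  obtain ⟨n, hn⟩ := hp (-s)
  have hMint : (0 : ℤ) < M := by exact_mod_cast hM0
  have hmem := toIcoMod_mem_Ico hMint (-((M + 1) / 2)) (j + n)
  have hdiv := toIcoMod_add_toIcoDiv_zsmul hMint (-((M + 1) / 2)) (j + n)
  set i := toIcoMod hMint (-((M + 1) / 2)) (j + n)
  set d := toIcoDiv hMint (-((M + 1) / 2)) (j + n)
  refine ⟨momentumOfLevels L s (m + l) i, ?_, (modEq_umklappVec_iff.mpr ⟨?_, ?_⟩).symm⟩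
  · rw [momentumOfLevels_mem_iff ha hM0 hM, Finset.mem_Ico]
    exact ⟨hmem.1, by have := hmem.2; omega⟩
  · rw [Pi.add_apply, momentumOfLevels_apply_self, momentumOfLevels_apply_self, hl]
    push_cast
    ring
  · rw [AddCommGroup.modEq_iff_eq_add_zsmul]
    refine ⟨d, ?_⟩
    have hdiv' : (j : ℝ) + n = i + d * M := by exact_mod_cast hdiv.symm
    have hperiod : 2 * Real.pi / a = 2 * Real.pi / L * M := by
      have : (0 : ℝ) < M := by exact_mod_cast hM0
      rw [hM]
      field_simp
    rw [Pi.add_apply, momentumOfLevels_apply_neg, momentumOfLevels_apply_neg, hn, hperiod,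
      zsmul_eq_mul]
    linear_combination 2 * Real.pi / L * hdiv'

/-- The allowed fermion momenta of an arc, parametrized by the quantum numbers along `e_s` and
`e_{-s}`. The `M = L/a` allowed quantum numbers along `e_{-s}` are those of the window
`-π/a ≤ k_{-s} < π/a`. -/
noncomputable def fermionMomentaEquiv (ha : 0 < a) (hM0 : 0 < M) (hM : L = M * a) (s : ℤˣ) :
    Finset.Ico (-((M + 1) / 2) : ℤ) (M / 2) × ℤ ≃ fermionMomenta L a s :=
  Equiv.ofBijective
    (fun x => ⟨momentumOfLevels L s x.2 x.1, (momentumOfLevels_mem_iff ha hM0 hM s _ _).mpr x.1.2⟩)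
    ⟨fun x y h => by
      have hL : L ≠ 0 := hM ▸ by positivity
      obtain ⟨hm, hj⟩ := momentumOfLevels_inj hL (Subtype.ext_iff.mp h)
      exact Prod.ext (Subtype.ext hj) hm,
    fun ⟨k, hk⟩ => by
      obtain ⟨m, j, rfl⟩ := exists_momentumOfLevels s hk.1
      exact ⟨(⟨j, (momentumOfLevels_mem_iff ha hM0 hM s m j).mp hk⟩, m), rfl⟩⟩

theorem fermionMomentaEquiv_apply_self (ha : 0 < a) (hM0 : 0 < M) (hM : L = M * a) (s : ℤˣ)
    (x : Finset.Ico (-((M + 1) / 2) : ℤ) (M / 2) × ℤ) :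
    (fermionMomentaEquiv ha hM0 hM s x).1 s = 2 * Real.pi / L * (x.2 + 1 / 2) :=
  momentumOfLevels_apply_self L s _ _

theorem finite_fermionMomenta_abs_le (ha : 0 < a) (hM0 : 0 < M) (hM : L = M * a) (s : ℤˣ)
    (E : ℝ) : {k : fermionMomenta L a s | |k.1 s| ≤ E}.Finite := by
  have hstep : 0 < 2 * Real.pi / L := by rw [hM]; positivity
  obtain ⟨N, hN⟩ := exists_nat_gt (E / (2 * Real.pi / L) + 1)
  refine Set.Finite.of_preimage (f := fermionMomentaEquiv ha hM0 hM s)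
    ((Set.finite_univ.prod (Set.finite_Icc (-(N : ℤ)) N)).subset ?_)
    (fermionMomentaEquiv ha hM0 hM s).surjective
  rintro x hx
  rw [Set.mem_preimage, Set.mem_ofPred_eq, fermionMomentaEquiv_apply_self, abs_mul,
    abs_of_pos hstep, mul_comm, ← le_div_iff₀ hstep, abs_le] at hx
  have hlower : (-(N : ℤ) : ℝ) ≤ x.2 := by push_cast; linarith
  have hupper : (x.2 : ℝ) ≤ N := by linarith
  exact ⟨Set.mem_univ _, by exact_mod_cast hlower, by exact_mod_cast hupper⟩

end NodalMomenta

section SpectralFlow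

theorem hasSum_sub_comp_add {G : Type*} [AddCommGroup G] [TopologicalSpace G]
    [IsTopologicalAddGroup G] {f : ℤ → G} {c : G} (hf : HasSum (fun m => f m - f (m + 1)) c)
    (q : ℤ) : HasSum (fun m => f m - f (m + q)) (q • c) := by
  have hshift (i : ℤ) : HasSum (fun m => f (m + i) - f (m + i + 1)) c :=
    (Equiv.addRight i).hasSum_iff.mpr hf
  induction q using Int.induction_on with
  | zero => simpa only [add_zero, sub_self, zero_smul] using hasSum_zero
  | succ i ih =>
    simpa only [add_one_zsmul, ← add_assoc, sub_add_sub_cancel] using ih.add (hshift i)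
  | pred i ih =>
    rw [sub_one_zsmul, ← sub_eq_add_neg]
    convert ih.sub (hshift (-i - 1)) using 2 with m
    rw [show m + (-(i : ℤ) - 1) + 1 = m + -i by ring]
    abel

theorem seaOcc_sub_succ (r : ℤˣ) (m : ℤ) :
    seaOcc (fun n : ℤ => ((r : ℤ) : ℝ) * (n + 1 / 2)) m -
      seaOcc (fun n : ℤ => ((r : ℤ) : ℝ) * (n + 1 / 2)) (m + 1) =
        if m = -1 then (r : ℂ) else 0 := by
  have hpos (n : ℤ) : 0 < ((r : ℤ) : ℝ) * (n + 1 / 2) ↔ 0 < (r : ℤ) * (2 * n + 1) := by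
    rw [← Int.cast_pos (R := ℝ), ← mul_pos_iff_of_pos_right (zero_lt_two' ℝ)]
    push_cast
    ring_nf
  simp only [seaOcc, hpos]
  rcases Int.units_eq_one_or r with rfl | rfl <;>
    simp only [Units.val_one, Units.val_neg, one_mul, neg_one_mul] <;>
    split_ifs <;> first | omega | norm_num

theorem hasSum_fintype_mul {ι κ : Type*} [Fintype ι] (f : ι → ℂ) {g : κ → ℂ} {c : ℂ}
    (hg : HasSum g c) : HasSum (fun x : ι × κ => f x.1 * g x.2) ((∑ i, f i) * c) :=
  (hasSum_fintype f).mul hg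
    (summable_mul_of_summable_norm (hasSum_fintype fun i => ‖f i‖).summable hg.summable.norm)

theorem hasSum_seaOcc_sub_add {L a : ℝ} {M : ℕ} (ha : 0 < a) (hM0 : 0 < M) (hM : L = M * a)
    (r s : ℤˣ) {p : ℤˣ → ℝ} (hp : p ∈ bosonMomenta L) :
    HasSum (fun k : fermionMomenta L a s => seaOcc (fun y : ℝ => ((r : ℤ) : ℝ) * y) (k.1 s) -
        seaOcc (fun y : ℝ => ((r : ℤ) : ℝ) * y) (k.1 s + p s))
      ((((r : ℤ) : ℝ) * p s * (L / (2 * Real.pi)) * (L / a) : ℝ) : ℂ) := by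
  obtain ⟨l, hl⟩ := hp s
  have hstep : 0 < 2 * Real.pi / L := by rw [hM]; positivity
  have hlevel (n : ℤ) : seaOcc (fun y : ℝ => ((r : ℤ) : ℝ) * y) (2 * Real.pi / L * (n + 1 / 2)) =
      seaOcc (fun n : ℤ => ((r : ℤ) : ℝ) * (n + 1 / 2)) n := by
    simp only [seaOcc, mul_left_comm _ (2 * Real.pi / L), mul_pos_iff_of_pos_left hstep]
  have hflow := hasSum_sub_comp_add (f := seaOcc fun n : ℤ => ((r : ℤ) : ℝ) * (n + 1 / 2))
    (by simpa only [seaOcc_sub_succ] using hasSum_ite_eq (-1) (r : ℂ)) l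
  rw [← (fermionMomentaEquiv ha hM0 hM s).hasSum_iff]
  convert hasSum_fintype_mul (fun _ => 1) hflow using 1
  · funext x
    rw [Function.comp_apply, fermionMomentaEquiv_apply_self, hl, one_mul, ← hlevel, ← hlevel]
    push_cast
    ring_nf
  · have hcard : ((M : ℤ) / 2 - -((M + 1) / 2)).toNat = M := by omega
    have hMa : L / a = M := by rw [hM]; field_simp
    have hl' : p s * (L / (2 * Real.pi)) = l := by rw [hl, hM]; field_simp
    rw [Finset.sum_const, Finset.card_univ, Fintype.card_coe, Int.card_Ico, hcard,
      mul_assoc (r : ℝ), hl', hMa]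
    push_cast
    simp only [nsmul_eq_mul, zsmul_eq_mul]
    ring

end SpectralFlow

section NodalMatrices

variable {L a : ℝ} {M : ℕ} {r s r' s' : ℤˣ} {p p' : ℤˣ → ℝ} {σ τ : Matrix (Fin 2) (Fin 2) ℂ}

/-- The one-particle energy `r k_s` of a nodal mode. -/
def modeEnergy (x : NodalMode L a) : ℝ := ((x.r : ℤ) : ℝ) * x.k.1 x.s

theorem finite_abs_modeEnergy_le (ha : 0 < a) (hM0 : 0 < M) (hM : L = M * a) (E : ℝ) :
    {x : NodalMode L a | |modeEnergy x| ≤ E}.Finite := by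
  have habs (r : ℤˣ) (y : ℝ) : |((r : ℤ) : ℝ) * y| = |y| := by
    rcases Int.units_eq_one_or r with rfl | rfl <;> simp
  have hmodes : {x : NodalMode L a | |modeEnergy x| ≤ E} ⊆ ⋃ (r : ℤˣ) (s : ℤˣ) (α : Fin 2),
      NodalMode.mk r s α '' {k : fermionMomenta L a s | |k.1 s| ≤ E} := by
    rintro ⟨r, s, α, k⟩ hk
    simp only [Set.mem_iUnion]
    exact ⟨r, s, α, k, (habs r (k.1 s)).symm.trans_le hk, rfl⟩
  exact (Set.finite_iUnion fun r => Set.finite_iUnion fun s => Set.finite_iUnion fun α =>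
    (finite_fermionMomenta_abs_le ha hM0 hM s E).image _).subset hmodes

open Classical in
/-- The one-particle operator whose second quantization is the nodal current with spin matrix `σ`:
it acts on the modes `(r, s)`, by `σ` on the spin and by `δ_{k₁ + p, k₂}`, modulo the reciprocal
vectors, on the momenta. -/
noncomputable def nodalMatrix (L a : ℝ) (r s : ℤˣ) (p : ℤˣ → ℝ) :
    Matrix (Fin 2) (Fin 2) ℂ →ₗ[ℂ] Matrix (NodalMode L a) (NodalMode L a) ℂ where
  toFun σ := Matrix.of fun x y =>
    if (x.r = r ∧ x.s = s) ∧ (y.r = r ∧ y.s = s) ∧ x.k.1 + p ≡ y.k.1 [PMOD umklappVec a s] then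
      σ x.α y.α
    else 0
  map_add' σ τ := by
    ext x y
    simp only [Matrix.of_apply, Matrix.add_apply]
    split_ifs
    exacts [rfl, (add_zero 0).symm]
  map_smul' c σ := by
    ext x y
    simp only [Matrix.of_apply, Matrix.smul_apply]
    split_ifs
    exacts [rfl, (smul_zero c).symm]

open Classical in
theorem nodalMatrix_mk (σ : Matrix (Fin 2) (Fin 2) ℂ) (α β : Fin 2)
    (k k' : fermionMomenta L a s) :
    nodalMatrix L a r s p σ ⟨r, s, α, k⟩ ⟨r, s, β, k'⟩ =
      if k.1 + p ≡ k'.1 [PMOD umklappVec a s] then σ α β else 0 :=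
  if_congr (by simp only [and_self, true_and]) rfl rfl

theorem of_nodalMatrix_ne_zero {x y : NodalMode L a} (h : nodalMatrix L a r s p σ x y ≠ 0) :
    (x.r = r ∧ x.s = s) ∧ (y.r = r ∧ y.s = s) ∧ x.k.1 + p ≡ y.k.1 [PMOD umklappVec a s] := by
  by_contra hxy
  exact h (if_neg hxy)

theorem exists_of_nodalMatrix_ne_zero {x y : NodalMode L a}
    (h : nodalMatrix L a r s p σ x y ≠ 0) : ∃ (α β : Fin 2) (k k' : fermionMomenta L a s),
      x = ⟨r, s, α, k⟩ ∧ y = ⟨r, s, β, k'⟩ ∧ k.1 + p ≡ k'.1 [PMOD umklappVec a s] := by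
  obtain ⟨r₁, s₁, α, k⟩ := x
  obtain ⟨r₂, s₂, β, k'⟩ := y
  obtain ⟨⟨rfl, rfl⟩, ⟨rfl, rfl⟩, hk⟩ := of_nodalMatrix_ne_zero h
  exact ⟨α, β, k, k', rfl, rfl, hk⟩

theorem shiftsBy_nodalMatrix (L a : ℝ) (r s : ℤˣ) (p : ℤˣ → ℝ) (σ : Matrix (Fin 2) (Fin 2) ℂ) :
    ShiftsBy modeEnergy (-(((r : ℤ) : ℝ) * p s)) (nodalMatrix L a r s p σ) := by
  intro x y h
  obtain ⟨α, β, k, k', rfl, rfl, hk⟩ := exists_of_nodalMatrix_ne_zero h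
  have hs : k.1 s + p s = k'.1 s := (modEq_umklappVec_iff.mp hk).1
  simp only [modeEnergy, ← hs]
  ring

theorem conjTranspose_nodalMatrix (L a : ℝ) (r s : ℤˣ) (p : ℤˣ → ℝ)
    (σ : Matrix (Fin 2) (Fin 2) ℂ) :
    (nodalMatrix L a r s p σ).conjTranspose = nodalMatrix L a r s (-p) σ.conjTranspose := by
  ext x y
  have hk : y.k.1 + p ≡ x.k.1 [PMOD umklappVec a s] ↔
      x.k.1 + -p ≡ y.k.1 [PMOD umklappVec a s] := by
    rw [← AddCommGroup.modEq_sub_iff_add_modEq, ← sub_eq_add_neg, AddCommGroup.modEq_comm]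
  classical
  exact (apply_ite star _ _ _).trans (if_congr (by tauto) rfl (star_zero ℂ))

theorem nodalMatrix_mul_eq_zero (h : (r, s) ≠ (r', s')) (x y z : NodalMode L a) :
    nodalMatrix L a r s p σ x y * nodalMatrix L a r' s' p' τ y z = 0 := by
  by_contra hne
  obtain ⟨-, ⟨hr, hs⟩, -⟩ := of_nodalMatrix_ne_zero (left_ne_zero_of_mul hne)
  obtain ⟨⟨hr', hs'⟩, -⟩ := of_nodalMatrix_ne_zero (right_ne_zero_of_mul hne)
  exact h (Prod.ext (hr.symm.trans hr') (hs.symm.trans hs'))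

theorem hasSum_nodalMatrix_mul_mk (ha : 0 < a) (hM0 : 0 < M) (hM : L = M * a)
    (hp : p ∈ bosonMomenta L) (p' : ℤˣ → ℝ) (σ τ : Matrix (Fin 2) (Fin 2) ℂ) (α β : Fin 2)
    (k l : fermionMomenta L a s) :
    HasSum (fun y =>
        nodalMatrix L a r s p σ ⟨r, s, α, k⟩ y * nodalMatrix L a r s p' τ y ⟨r, s, β, l⟩)
      (nodalMatrix L a r s (p + p') (σ * τ) ⟨r, s, α, k⟩ ⟨r, s, β, l⟩) := by
  obtain ⟨k', hk', hkk'⟩ := exists_modEq_umklappVec ha hM0 hM k.2 hp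
  let mode (γ : Fin 2) : NodalMode L a := ⟨r, s, γ, ⟨k', hk'⟩⟩
  have hmode : Function.Injective mode := fun γ γ' h => congrArg NodalMode.α h
  refine (hmode.hasSum_iff ?_).mp ?_
  · intro y hy
    by_contra hne
    obtain ⟨_, γ, k₁, k₂, hx, rfl, hk⟩ :=
      exists_of_nodalMatrix_ne_zero (left_ne_zero_of_mul hne)
    cases hx
    have hk₂ : (⟨k', hk'⟩ : fermionMomenta L a s) = k₂ :=
      Subtype.ext (eq_of_modEq_umklappVec ha hk' k₂.2 (hkk'.symm.trans hk))
    exact hy ⟨γ, by simp only [mode, hk₂]⟩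
  · have hl : k.1 + (p + p') ≡ l.1 [PMOD umklappVec a s] ↔
        k' + p' ≡ l.1 [PMOD umklappVec a s] := by
      rw [← add_assoc]
      exact ⟨(hkk'.add_right p').symm.trans, (hkk'.add_right p').trans⟩
    have hcoeff : nodalMatrix L a r s (p + p') (σ * τ) ⟨r, s, α, k⟩ ⟨r, s, β, l⟩ =
        ∑ γ, nodalMatrix L a r s p σ ⟨r, s, α, k⟩ (mode γ) *
          nodalMatrix L a r s p' τ (mode γ) ⟨r, s, β, l⟩ := by
      simp only [mode, nodalMatrix_mk, if_pos hkk']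
      by_cases h : k' + p' ≡ l.1 [PMOD umklappVec a s]
      · simp only [if_pos h, if_pos (hl.mpr h), Matrix.mul_apply]
      · simp only [if_neg h, if_neg (mt hl.mp h), mul_zero, Finset.sum_const_zero]
    rw [hcoeff]
    exact hasSum_fintype _

theorem hasSum_nodalMatrix_mul (ha : 0 < a) (hM0 : 0 < M) (hM : L = M * a) (r s : ℤˣ)
    (hp : p ∈ bosonMomenta L) (p' : ℤˣ → ℝ) (σ τ : Matrix (Fin 2) (Fin 2) ℂ)
    (x z : NodalMode L a) :
    HasSum (fun y => nodalMatrix L a r s p σ x y * nodalMatrix L a r s p' τ y z)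
      (nodalMatrix L a r s (p + p') (σ * τ) x z) := by
  by_cases hx : x.r = r ∧ x.s = s
  swap
  · have hzero (p : ℤˣ → ℝ) (σ : Matrix (Fin 2) (Fin 2) ℂ) (y : NodalMode L a) :
        nodalMatrix L a r s p σ x y = 0 := if_neg fun h => hx h.1
    simpa only [hzero, zero_mul] using hasSum_zero
  by_cases hz : z.r = r ∧ z.s = s
  swap
  · have hzero (p : ℤˣ → ℝ) (σ : Matrix (Fin 2) (Fin 2) ℂ) (y : NodalMode L a) :
        nodalMatrix L a r s p σ y z = 0 := if_neg fun h => hz h.2.1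
    simpa only [hzero, mul_zero] using hasSum_zero
  obtain ⟨_, _, α, k⟩ := x
  obtain ⟨_, _, β, l⟩ := z
  obtain ⟨rfl, rfl⟩ := hx
  obtain ⟨rfl, rfl⟩ := hz
  exact hasSum_nodalMatrix_mul_mk ha hM0 hM hp p' σ τ α β k l

theorem hasSum_nodalMatrix_commutator (ha : 0 < a) (hM0 : 0 < M) (hM : L = M * a) (r s : ℤˣ)
    (hp : p ∈ bosonMomenta L) (hp' : p' ∈ bosonMomenta L) (σ τ : Matrix (Fin 2) (Fin 2) ℂ)
    (x z : NodalMode L a) :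
    HasSum (fun y => nodalMatrix L a r s p σ x y * nodalMatrix L a r s p' τ y z -
        nodalMatrix L a r s p' τ x y * nodalMatrix L a r s p σ y z)
      (nodalMatrix L a r s (p + p') (σ * τ - τ * σ) x z) := by
  rw [map_sub, Matrix.sub_apply]
  nth_rw 2 [add_comm p p']
  exact (hasSum_nodalMatrix_mul ha hM0 hM r s hp p' σ τ x z).sub
    (hasSum_nodalMatrix_mul ha hM0 hM r s hp' p τ σ x z)

theorem nodalMatrix_mul_swap_eq_zero (h : ¬p + p' ≡ 0 [PMOD umklappVec a s]) (r : ℤˣ)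
    (σ τ : Matrix (Fin 2) (Fin 2) ℂ) (x y : NodalMode L a) :
    nodalMatrix L a r s p σ x y * nodalMatrix L a r s p' τ y x = 0 := by
  by_contra hne
  obtain ⟨-, -, hxy⟩ := of_nodalMatrix_ne_zero (left_ne_zero_of_mul hne)
  obtain ⟨-, -, hyx⟩ := of_nodalMatrix_ne_zero (right_ne_zero_of_mul hne)
  have hloop : x.k.1 + (p + p') ≡ x.k.1 [PMOD umklappVec a s] := by
    rw [← add_assoc]
    exact (hxy.add_right p').trans hyx
  exact h (AddCommGroup.add_modEq_left.mp hloop)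

theorem hasSum_nodalMatrix_mul_swap_of_modEq (ha : 0 < a) (hM0 : 0 < M) (hM : L = M * a) (r s : ℤˣ)
    (hp : p ∈ bosonMomenta L) (hpp' : p + p' ≡ 0 [PMOD umklappVec a s])
    (σ τ : Matrix (Fin 2) (Fin 2) ℂ) :
    HasSum (fun q : NodalMode L a × NodalMode L a =>
        nodalMatrix L a r s p σ q.1 q.2 * nodalMatrix L a r s p' τ q.2 q.1 *
          (seaOcc modeEnergy q.1 - seaOcc modeEnergy q.2))
      ((σ * τ).trace *
        ((((r : ℤ) : ℝ) * p s * (L / (2 * Real.pi)) * (L / a) : ℝ) : ℂ)) := by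
  have hshift (k : fermionMomenta L a s) :
      ∃ k' : fermionMomenta L a s, k.1 + p ≡ k'.1 [PMOD umklappVec a s] := by
    obtain ⟨k', hk', h⟩ := exists_modEq_umklappVec ha hM0 hM k.2 hp
    exact ⟨⟨k', hk'⟩, h⟩
  choose shift hshift using hshift
  let modes (x : (Fin 2 × Fin 2) × fermionMomenta L a s) : NodalMode L a × NodalMode L a :=
    (⟨r, s, x.1.1, x.2⟩, ⟨r, s, x.1.2, shift x.2⟩)
  have hmodes : Function.Injective modes := by
    rintro ⟨⟨α, β⟩, k⟩ ⟨⟨α', β'⟩, k'⟩ h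
    simp only [modes, Prod.mk.injEq, NodalMode.mk.injEq, heq_eq_eq, true_and] at h
    obtain ⟨⟨rfl, rfl⟩, rfl, -⟩ := h
    rfl
  refine (hmodes.hasSum_iff ?_).mp ?_
  · rintro ⟨x, y⟩ hxy
    by_contra hne
    obtain ⟨α, β, k, k', rfl, rfl, hk⟩ :=
      exists_of_nodalMatrix_ne_zero (left_ne_zero_of_mul (left_ne_zero_of_mul hne))
    have hk' : shift k = k' := Subtype.ext
      (eq_of_modEq_umklappVec ha (shift k).2 k'.2 ((hshift k).symm.trans hk))
    exact hxy ⟨((α, β), k), by simp only [modes, hk']⟩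
  · have htrace : (σ * τ).trace = ∑ q : Fin 2 × Fin 2, σ q.1 q.2 * τ q.2 q.1 := by
      simp only [Fintype.sum_prod_type, Matrix.trace, Matrix.diag, Matrix.mul_apply]
    rw [htrace]
    convert hasSum_fintype_mul (fun q : Fin 2 × Fin 2 => σ q.1 q.2 * τ q.2 q.1)
      (hasSum_seaOcc_sub_add ha hM0 hM r s hp) using 2 with x
    have hback : (shift x.2).1 + p' ≡ x.2.1 [PMOD umklappVec a s] := by
      have hsum := (AddCommGroup.add_modEq_left (a := x.2.1)).mpr hpp'
      rw [← add_assoc] at hsum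
      exact ((hshift x.2).add_right p').symm.trans hsum
    have hs : (shift x.2).1 s = x.2.1 s + p s := (modEq_umklappVec_iff.mp (hshift x.2)).1.symm
    simp only [Function.comp_apply, modes, nodalMatrix_mk, if_pos (hshift x.2), if_pos hback,
      ← hs]
    rfl

theorem hasSum_nodalMatrix_mul_swap (ha : 0 < a) (hM0 : 0 < M) (hM : L = M * a) (r s : ℤˣ)
    (hp : p ∈ bosonMomenta L) (p' : ℤˣ → ℝ) (σ τ : Matrix (Fin 2) (Fin 2) ℂ) :
    HasSum (fun q : NodalMode L a × NodalMode L a =>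
        nodalMatrix L a r s p σ q.1 q.2 * nodalMatrix L a r s p' τ q.2 q.1 *
          (seaOcc modeEnergy q.1 - seaOcc modeEnergy q.2))
      ((σ * τ).trace * ((((r : ℤ) : ℝ) * p s * (L / (2 * Real.pi)) * (L / a) : ℝ) : ℂ) *
        umklappDelta a s (p + p')) := by
  rw [umklappDelta_eq_ite ha.ne']
  split_ifs with hpp'
  · simpa only [mul_one] using
      hasSum_nodalMatrix_mul_swap_of_modEq ha hM0 hM r s hp hpp' σ τ
  · simpa only [nodalMatrix_mul_swap_eq_zero hpp', zero_mul, mul_zero] using hasSum_zero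

end NodalMatrices

section PauliMatrices

theorem pauli_conjTranspose (μ : Fin 4) : (pauli μ).conjTranspose = pauli μ := by
  fin_cases μ <;> ext i j <;> fin_cases i <;> fin_cases j <;>
    simp [pauli, Matrix.conjTranspose_apply]

/-- The spin matrices `σ^i / 2`, `i = 1, 2, 3` (the index runs over `0, 1, 2` here). -/
noncomputable def spinMatrix (i : Fin 3) : Matrix (Fin 2) (Fin 2) ℂ := (1 / 2 : ℂ) • pauli i.succ

theorem trace_spinMatrix (i : Fin 3) : (spinMatrix i).trace = 0 := by
  fin_cases i <;> simp [spinMatrix, pauli, Matrix.trace]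

theorem trace_spinMatrix_mul (i j : Fin 3) :
    (spinMatrix i * spinMatrix j).trace = if i = j then 1 / 2 else 0 := by
  have hpauli : (pauli i.succ * pauli j.succ).trace = if i = j then 2 else 0 := by
    fin_cases i <;> fin_cases j <;> simp [pauli, Matrix.trace_fin_two] <;> norm_num
  rw [spinMatrix, spinMatrix, smul_mul_smul_comm, Matrix.trace_smul, hpauli]
  split_ifs <;> norm_num

theorem spinMatrix_commutator (i j : Fin 3) :
    spinMatrix i * spinMatrix j - spinMatrix j * spinMatrix i =
      ∑ k : Fin 3, (Complex.I * leviCivita i j k) • spinMatrix k := by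
  have hpauli : pauli i.succ * pauli j.succ - pauli j.succ * pauli i.succ =
      ∑ k : Fin 3, (2 * Complex.I * leviCivita i j k) • pauli k.succ := by
    fin_cases i <;> fin_cases j <;> ext x y <;> fin_cases x <;> fin_cases y <;>
      simp [pauli, leviCivita, Fin.sum_univ_three] <;> ring_nf <;> simp
  simp only [spinMatrix, smul_mul_smul_comm]
  rw [← smul_sub, hpauli, Finset.smul_sum]
  refine Finset.sum_congr rfl fun k _ => ?_
  rw [smul_smul, smul_smul]
  ring_nf

end PauliMatrices

section NodalOperators

variable {L a : ℝ} {M : ℕ} {r s r' s' : ℤˣ} {p p' : ℤˣ → ℝ} {σ τ : Matrix (Fin 2) (Fin 2) ℂ}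
  {φ v : NodalFock L a}

theorem normalOrder_smul (c : ℂ) (O : NodalFock L a →L[ℂ] NodalFock L a) :
    normalOrder (c • O) = c • normalOrder O := by
  simp only [normalOrder, smul_apply, inner_smul_right, smul_sub, smul_smul]

theorem normalOrder_adjoint_nodalFermion_comp (r s : ℤˣ) (α β : Fin 2)
    (k₁ k₂ : fermionMomenta L a s) :
    normalOrder ((nodalFermion L a r s α k₁).adjoint ∘L nodalFermion L a r s β k₂) =
      (((L / (2 * Real.pi)) ^ 2 : ℝ) : ℂ) •
        normalBilinear modeEnergy (⟨r, s, α, k₁⟩ : NodalMode L a) ⟨r, s, β, k₂⟩ := by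
  have hψ (α : Fin 2) (k : fermionMomenta L a s) : nodalFermion L a r s α k =
      ((L / (2 * Real.pi) : ℝ) : ℂ) • fieldOp modeEnergy (⟨r, s, α, k⟩ : NodalMode L a) := rfl
  rw [hψ, hψ, map_smulₛₗ, ContinuousLinearMap.smul_comp, ContinuousLinearMap.comp_smul, smul_smul,
    Complex.conj_ofReal, ← Complex.ofReal_mul, ← pow_two, normalOrder_smul]
  rfl

open Classical in
theorem bilinearTerm_eq (hL : L ≠ 0) (μ : Fin 4) (r s : ℤˣ) (p : ℤˣ → ℝ) (α β : Fin 2)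
    (k₁ k₂ : fermionMomenta L a s) (n : ℤ) :
    bilinearTerm L a μ r s p (α, β, k₁, k₂, n) =
      if k₁.1 + p = k₂.1 + n • umklappVec a s then
        pauli μ α β • normalBilinear modeEnergy (⟨r, s, α, k₁⟩ : NodalMode L a) ⟨r, s, β, k₂⟩
      else 0 := by
  have hnorm : (2 * Real.pi / L) ^ 2 * (L / (2 * Real.pi)) ^ 2 = 1 := by
    have := Real.pi_ne_zero
    field_simp
  rw [bilinearTerm, zsmul_umklappVec]
  refine if_congr Iff.rfl ?_ rfl
  rw [normalOrder_smul, normalOrder_adjoint_nodalFermion_comp, smul_smul, smul_smul,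
    mul_right_comm, ← Complex.ofReal_mul, hnorm, Complex.ofReal_one, one_mul]

/-- The second quantization of the nodal matrix with spin part `σ`. -/
noncomputable abbrev nodalQuant (L a : ℝ) (r s : ℤˣ) (p : ℤˣ → ℝ)
    (σ : Matrix (Fin 2) (Fin 2) ℂ) : NodalFock L a →ₗ.[ℂ] NodalFock L a :=
  secondQuant modeEnergy (nodalMatrix L a r s p σ)

-- Two momenta determine the umklapp index `n`, so the two series have the same nonzero terms.
theorem hasSum_bilinearTerm_iff (hL : L ≠ 0) (ha : a ≠ 0) (μ : Fin 4) :
    HasSum (fun i => bilinearTerm L a μ r s p i φ) v ↔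
      HasSum (fun q : NodalMode L a × NodalMode L a =>
        (nodalMatrix L a r s p (pauli μ) q.1 q.2 • normalBilinear modeEnergy q.1 q.2) φ) v := by
  classical
  have hne {α β : Fin 2} {k₁ k₂ : fermionMomenta L a s} {n : ℤ}
      (h : bilinearTerm L a μ r s p (α, β, k₁, k₂, n) φ ≠ 0) :
      k₁.1 + p = k₂.1 + n • umklappVec a s := by
    by_contra hc
    rw [bilinearTerm_eq hL, if_neg hc] at h
    exact h rfl
  symm
  refine hasSum_iff_hasSum_of_ne_zero_bij
    (fun i => (⟨r, s, i.1.1, i.1.2.2.1⟩, ⟨r, s, i.1.2.1, i.1.2.2.2.1⟩)) ?_ ?_ ?_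
  · rintro ⟨⟨α, β, k₁, k₂, n⟩, hi⟩ ⟨⟨α', β', k₁', k₂', n'⟩, hi'⟩ h
    simp only [Prod.mk.injEq, NodalMode.mk.injEq, heq_eq_eq, true_and] at h
    obtain ⟨⟨rfl, rfl⟩, rfl, rfl⟩ := h
    obtain rfl := zsmul_umklappVec_injective ha s (add_left_cancel ((hne hi).symm.trans (hne hi')))
    rfl
  · rintro ⟨x, y⟩ hq
    have hU : nodalMatrix L a r s p (pauli μ) x y ≠ 0 := fun h => hq (by
      simp only [h, zero_smul, zero_apply])
    obtain ⟨α, β, k₁, k₂, rfl, rfl, hk⟩ := exists_of_nodalMatrix_ne_zero hU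
    obtain ⟨n, hn⟩ := AddCommGroup.modEq_iff_eq_add_zsmul.mp hk.symm
    refine ⟨⟨(α, β, k₁, k₂, n), ?_⟩, rfl⟩
    rw [Function.mem_support, nodalMatrix_mk, if_pos hk] at hq
    rwa [Function.mem_support, bilinearTerm_eq hL, if_pos hn]
  · rintro ⟨⟨α, β, k₁, k₂, n⟩, hi⟩
    have hk := (AddCommGroup.modEq_iff_eq_add_zsmul.mpr ⟨n, hne hi⟩).symm
    rw [bilinearTerm_eq hL, if_pos (hne hi), nodalMatrix_mk, if_pos hk]

theorem bilinearSeries_eq (hL : L ≠ 0) (ha : a ≠ 0) (μ : Fin 4) (r s : ℤˣ) (p : ℤˣ → ℝ) :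
    bilinearSeries L a μ r s p = nodalQuant L a r s p (pauli μ) :=
  seriesPMap_congr (T := bilinearTerm L a μ r s p) fun _ _ => hasSum_bilinearTerm_iff hL ha μ

theorem diracVacuum_mem_finiteExcitations : diracVacuum L a ∈ finiteExcitations L a :=
  Submodule.subset_span ⟨∅, rfl⟩

theorem act_nodalQuant_vacuum (σ : Matrix (Fin 2) (Fin 2) ℂ) (h : 0 ≤ ((r : ℤ) : ℝ) * p s) :
    act (nodalQuant L a r s p σ) (diracVacuum L a) = 0 :=
  act_eq_of_mem_graph
    (secondQuant_vacuum (shiftsBy_nodalMatrix L a r s p σ) (neg_nonpos.mpr h))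

section Domain

variable (ha : 0 < a) (hM0 : 0 < M) (hM : L = M * a)
include ha hM0 hM

theorem act_nodalQuant_sum_smul {K : Type*} (t : Finset K) (c : K → ℂ)
    (σ : K → Matrix (Fin 2) (Fin 2) ℂ) (hφ : φ ∈ finiteExcitations L a) :
    act (nodalQuant L a r s p (∑ k ∈ t, c k • σ k)) φ =
      ∑ k ∈ t, c k • act (nodalQuant L a r s p (σ k)) φ := by
  rw [nodalQuant, map_sum]
  simp only [map_smul]
  exact act_secondQuant_sum_smul (finite_abs_modeEnergy_le ha hM0 hM) c
    (fun k _ => shiftsBy_nodalMatrix L a r s p (σ k)) hφ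

theorem act_nodalQuant_smul (c : ℂ) (hφ : φ ∈ finiteExcitations L a) :
    act (nodalQuant L a r s p (c • σ)) φ = c • act (nodalQuant L a r s p σ) φ := by
  simpa only [Finset.sum_singleton] using
    act_nodalQuant_sum_smul ha hM0 hM {()} (fun _ => c) (fun _ => σ) hφ

theorem act_nodalQuant_mem_finiteExcitations (hφ : φ ∈ finiteExcitations L a) :
    act (nodalQuant L a r s p σ) φ ∈ finiteExcitations L a :=
  act_secondQuant_mem_span_occVec (finite_abs_modeEnergy_le ha hM0 hM)
    (shiftsBy_nodalMatrix L a r s p σ) hφ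

theorem commAt_congr_nodalQuant {A B : NodalFock L a →ₗ.[ℂ] NodalFock L a}
    (hA : ∀ φ ∈ finiteExcitations L a, act A φ = act (nodalQuant L a r s p σ) φ)
    (hB : ∀ φ ∈ finiteExcitations L a, act B φ = act (nodalQuant L a r' s' p' τ) φ)
    (hφ : φ ∈ finiteExcitations L a) :
    commAt A B φ = commAt (nodalQuant L a r s p σ) (nodalQuant L a r' s' p' τ) φ :=
  commAt_congr hA hB (fun _ => act_nodalQuant_mem_finiteExcitations ha hM0 hM)
    (fun _ => act_nodalQuant_mem_finiteExcitations ha hM0 hM) hφ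

theorem commAt_nodalQuant (hp : p ∈ bosonMomenta L) (hp' : p' ∈ bosonMomenta L)
    (σ τ : Matrix (Fin 2) (Fin 2) ℂ) (hφ : φ ∈ finiteExcitations L a) :
    commAt (nodalQuant L a r s p σ) (nodalQuant L a r s p' τ) φ =
      act (nodalQuant L a r s (p + p') (σ * τ - τ * σ)) φ +
        ((σ * τ).trace * ((((r : ℤ) : ℝ) * p s * (L / (2 * Real.pi)) * (L / a) : ℝ) : ℂ) *
          umklappDelta a s (p + p')) • φ :=
  commAt_secondQuant (finite_abs_modeEnergy_le ha hM0 hM) (shiftsBy_nodalMatrix L a r s p σ)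
    (shiftsBy_nodalMatrix L a r s p' τ)
    (hasSum_nodalMatrix_commutator ha hM0 hM r s hp hp' σ τ)
    (hasSum_nodalMatrix_mul_swap ha hM0 hM r s hp p' σ τ) hφ

theorem commAt_nodalQuant_of_commute (hp : p ∈ bosonMomenta L) (hp' : p' ∈ bosonMomenta L)
    (hστ : Commute σ τ) (hφ : φ ∈ finiteExcitations L a) :
    commAt (nodalQuant L a r s p σ) (nodalQuant L a r s p' τ) φ =
      ((σ * τ).trace * ((((r : ℤ) : ℝ) * p s * (L / (2 * Real.pi)) * (L / a) : ℝ) : ℂ) *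
        umklappDelta a s (p + p')) • φ := by
  rw [commAt_nodalQuant ha hM0 hM hp hp' σ τ hφ, hστ.eq, sub_self, nodalQuant, map_zero,
    act_secondQuant_zero, zero_add]

theorem commAt_nodalQuant_of_ne (h : (r, s) ≠ (r', s')) (p p' : ℤˣ → ℝ)
    (σ τ : Matrix (Fin 2) (Fin 2) ℂ) (hφ : φ ∈ finiteExcitations L a) :
    commAt (nodalQuant L a r s p σ) (nodalQuant L a r' s' p' τ) φ = 0 := by
  rw [commAt_secondQuant (C := 0) (κ := 0) (finite_abs_modeEnergy_le ha hM0 hM)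
    (shiftsBy_nodalMatrix L a r s p σ) (shiftsBy_nodalMatrix L a r' s' p' τ) ?_ ?_ hφ,
    act_secondQuant_zero, zero_smul, add_zero]
  · intro x z
    simpa only [nodalMatrix_mul_eq_zero h, nodalMatrix_mul_eq_zero h.symm, sub_zero,
      Matrix.zero_apply] using hasSum_zero
  · simpa only [nodalMatrix_mul_eq_zero h, zero_mul] using hasSum_zero

theorem nodalCurrent_eq_closure (μ : Fin 4) (r s : ℤˣ) (p : ℤˣ → ℝ) :
    nodalCurrent L a μ r s p = (nodalQuant L a r s p (pauli μ)).closure := by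
  have hL : L ≠ 0 := hM ▸ (mul_pos (Nat.cast_pos.mpr hM0) ha).ne'
  rw [nodalCurrent, bilinearSeries_eq hL ha.ne']

theorem finiteExcitations_le_domain_bilinearSeries (μ : Fin 4) (r s : ℤˣ) (p : ℤˣ → ℝ) :
    finiteExcitations L a ≤ (bilinearSeries L a μ r s p).domain := by
  have hL : L ≠ 0 := hM ▸ (mul_pos (Nat.cast_pos.mpr hM0) ha).ne'
  rw [bilinearSeries_eq hL ha.ne']
  exact span_occVec_le_domain_secondQuant (finite_abs_modeEnergy_le ha hM0 hM)
    (shiftsBy_nodalMatrix L a r s p (pauli μ))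

theorem isClosable_bilinearSeries (μ : Fin 4) (r s : ℤˣ) (p : ℤˣ → ℝ) :
    (bilinearSeries L a μ r s p).IsClosable := by
  have hL : L ≠ 0 := hM ▸ (mul_pos (Nat.cast_pos.mpr hM0) ha).ne'
  rw [bilinearSeries_eq hL ha.ne']
  exact isClosable_secondQuant (finite_abs_modeEnergy_le ha hM0 hM)
    (shiftsBy_nodalMatrix L a r s p (pauli μ))

theorem hasCore_nodalCurrent (μ : Fin 4) (r s : ℤˣ) (p : ℤˣ → ℝ) :
    (nodalCurrent L a μ r s p).HasCore (finiteExcitations L a) := by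
  rw [nodalCurrent_eq_closure ha hM0 hM]
  exact hasCore_closure_secondQuant (finite_abs_modeEnergy_le ha hM0 hM)
    (shiftsBy_nodalMatrix L a r s p (pauli μ))

theorem adjoint_nodalCurrent (μ : Fin 4) (r s : ℤˣ) (p : ℤˣ → ℝ) :
    (nodalCurrent L a μ r s p).adjoint = nodalCurrent L a μ r s (-p) := by
  rw [nodalCurrent_eq_closure ha hM0 hM, nodalCurrent_eq_closure ha hM0 hM,
    adjoint_closure_secondQuant (finite_abs_modeEnergy_le ha hM0 hM)
      (shiftsBy_nodalMatrix L a r s p (pauli μ)), conjTranspose_nodalMatrix, pauli_conjTranspose]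

theorem adjoint_nodalSpin (i : Fin 3) (r s : ℤˣ) (p : ℤˣ → ℝ) :
    (nodalSpin L a i r s p).adjoint = nodalSpin L a i r s (-p) := by
  have hdense : Dense ((nodalCurrent L a i.succ r s p).domain : Set (NodalFock L a)) :=
    dense_span_occVec.mono (hasCore_nodalCurrent ha hM0 hM i.succ r s p).le_domain
  rw [nodalSpin, adjoint_smul hdense (by norm_num), adjoint_nodalCurrent ha hM0 hM, nodalSpin,
    map_div₀, map_one, map_ofNat]

theorem act_nodalCurrent (μ : Fin 4) (r s : ℤˣ) (p : ℤˣ → ℝ) (hφ : φ ∈ finiteExcitations L a) :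
    act (nodalCurrent L a μ r s p) φ = act (nodalQuant L a r s p (pauli μ)) φ := by
  rw [nodalCurrent_eq_closure ha hM0 hM]
  exact act_eq_of_le (LinearPMap.le_closure _) (span_occVec_le_domain_secondQuant
    (finite_abs_modeEnergy_le ha hM0 hM) (shiftsBy_nodalMatrix L a r s p (pauli μ)) hφ)

theorem act_nodalDensity (r s : ℤˣ) (p : ℤˣ → ℝ) (hφ : φ ∈ finiteExcitations L a) :
    act (nodalDensity L a r s p) φ = act (nodalQuant L a r s p 1) φ :=
  act_nodalCurrent ha hM0 hM 0 r s p hφ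

theorem act_nodalSpin (i : Fin 3) (r s : ℤˣ) (p : ℤˣ → ℝ) (hφ : φ ∈ finiteExcitations L a) :
    act (nodalSpin L a i r s p) φ = act (nodalQuant L a r s p (spinMatrix i)) φ := by
  rw [nodalSpin, act_smul, act_nodalCurrent ha hM0 hM _ r s p hφ, spinMatrix,
    act_nodalQuant_smul ha hM0 hM _ hφ]

theorem act_nodalDensity_mem (r s : ℤˣ) (p : ℤˣ → ℝ) (hφ : φ ∈ finiteExcitations L a) :
    act (nodalDensity L a r s p) φ ∈ finiteExcitations L a := by
  rw [act_nodalDensity ha hM0 hM r s p hφ]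
  exact act_nodalQuant_mem_finiteExcitations ha hM0 hM hφ

theorem act_nodalSpin_mem (i : Fin 3) (r s : ℤˣ) (p : ℤˣ → ℝ) (hφ : φ ∈ finiteExcitations L a) :
    act (nodalSpin L a i r s p) φ ∈ finiteExcitations L a := by
  rw [act_nodalSpin ha hM0 hM i r s p hφ]
  exact act_nodalQuant_mem_finiteExcitations ha hM0 hM hφ

theorem commAt_nodalDensity (r s : ℤˣ) (hp : p ∈ bosonMomenta L) (hp' : p' ∈ bosonMomenta L)
    (hφ : φ ∈ finiteExcitations L a) :
    commAt (nodalDensity L a r s p) (nodalDensity L a r s p') φ =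
      ((((r : ℤ) : ℝ) * (4 * Real.pi * p s / a) * (L / (2 * Real.pi)) ^ 2 : ℝ) : ℂ) •
        umklappDelta a s (p + p') • φ := by
  have hconst : ((r : ℤ) : ℝ) * (4 * Real.pi * p s / a) * (L / (2 * Real.pi)) ^ 2 =
      2 * (((r : ℤ) : ℝ) * p s * (L / (2 * Real.pi)) * (L / a)) := by
    have := Real.pi_ne_zero
    field_simp
    ring
  rw [commAt_congr_nodalQuant ha hM0 hM (fun _ => act_nodalDensity ha hM0 hM r s p)
      (fun _ => act_nodalDensity ha hM0 hM r s p') hφ,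
    commAt_nodalQuant_of_commute ha hM0 hM hp hp' (Commute.refl 1) hφ, smul_smul, hconst, mul_one,
    Matrix.trace_one, Fintype.card_fin, Complex.ofReal_mul 2, Complex.ofReal_ofNat, Nat.cast_ofNat]

theorem commAt_nodalSpin (r s : ℤˣ) (i j : Fin 3) (hp : p ∈ bosonMomenta L)
    (hp' : p' ∈ bosonMomenta L) (hφ : φ ∈ finiteExcitations L a) :
    commAt (nodalSpin L a i r s p) (nodalSpin L a j r s p') φ =
      (Complex.I • ∑ k : Fin 3, leviCivita i j k • act (nodalSpin L a k r s (p + p')) φ) +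
        (if i = j then (1 : ℂ) else 0) •
          ((((r : ℤ) : ℝ) * (Real.pi * p s / a) * (L / (2 * Real.pi)) ^ 2 : ℝ) : ℂ) •
            umklappDelta a s (p + p') • φ := by
  have hconst : ((r : ℤ) : ℝ) * (Real.pi * p s / a) * (L / (2 * Real.pi)) ^ 2 =
      1 / 2 * (((r : ℤ) : ℝ) * p s * (L / (2 * Real.pi)) * (L / a)) := by
    have := Real.pi_ne_zero
    field_simp
  rw [commAt_congr_nodalQuant ha hM0 hM (fun _ => act_nodalSpin ha hM0 hM i r s p)
      (fun _ => act_nodalSpin ha hM0 hM j r s p') hφ,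
    commAt_nodalQuant ha hM0 hM hp hp' _ _ hφ, spinMatrix_commutator, trace_spinMatrix_mul,
    act_nodalQuant_sum_smul ha hM0 hM _ _ _ hφ, hconst, Finset.smul_sum]
  congr 1
  · refine Finset.sum_congr rfl fun k _ => ?_
    rw [smul_smul, act_nodalSpin ha hM0 hM k r s (p + p') hφ]
  · rw [smul_smul, smul_smul]
    push_cast
    split_ifs <;> ring_nf

theorem commAt_nodalDensity_nodalSpin (r s r' s' : ℤˣ) (i : Fin 3) (hp : p ∈ bosonMomenta L)
    (hp' : p' ∈ bosonMomenta L) (hφ : φ ∈ finiteExcitations L a) :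
    commAt (nodalDensity L a r s p) (nodalSpin L a i r' s' p') φ = 0 := by
  rw [commAt_congr_nodalQuant ha hM0 hM (fun _ => act_nodalDensity ha hM0 hM r s p)
    (fun _ => act_nodalSpin ha hM0 hM i r' s' p') hφ]
  by_cases h : (r, s) = (r', s')
  · obtain ⟨rfl, rfl⟩ := Prod.mk.inj h
    rw [commAt_nodalQuant_of_commute ha hM0 hM hp hp' (Commute.one_left _) hφ, one_mul,
      trace_spinMatrix, zero_mul, zero_mul, zero_smul]
  · exact commAt_nodalQuant_of_ne ha hM0 hM h p p' 1 (spinMatrix i) hφ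

theorem commAt_nodalDensity_of_ne (h : (r, s) ≠ (r', s')) (p p' : ℤˣ → ℝ)
    (hφ : φ ∈ finiteExcitations L a) :
    commAt (nodalDensity L a r s p) (nodalDensity L a r' s' p') φ = 0 := by
  rw [commAt_congr_nodalQuant ha hM0 hM (fun _ => act_nodalDensity ha hM0 hM r s p)
    (fun _ => act_nodalDensity ha hM0 hM r' s' p') hφ]
  exact commAt_nodalQuant_of_ne ha hM0 hM h p p' 1 1 hφ

theorem commAt_nodalSpin_of_ne (h : (r, s) ≠ (r', s')) (i j : Fin 3) (p p' : ℤˣ → ℝ)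
    (hφ : φ ∈ finiteExcitations L a) :
    commAt (nodalSpin L a i r s p) (nodalSpin L a j r' s' p') φ = 0 := by
  rw [commAt_congr_nodalQuant ha hM0 hM (fun _ => act_nodalSpin ha hM0 hM i r s p)
    (fun _ => act_nodalSpin ha hM0 hM j r' s' p') hφ]
  exact commAt_nodalQuant_of_ne ha hM0 hM h p p' _ _ hφ

theorem act_nodalDensity_vacuum (h : 0 ≤ ((r : ℤ) : ℝ) * p s) :
    act (nodalDensity L a r s p) (diracVacuum L a) = 0 := by
  rw [act_nodalDensity ha hM0 hM r s p diracVacuum_mem_finiteExcitations,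
    act_nodalQuant_vacuum 1 h]

theorem act_nodalSpin_vacuum (i : Fin 3) (h : 0 ≤ ((r : ℤ) : ℝ) * p s) :
    act (nodalSpin L a i r s p) (diracVacuum L a) = 0 := by
  rw [act_nodalSpin ha hM0 hM i r s p diracVacuum_mem_finiteExcitations,
    act_nodalQuant_vacuum _ h]

end Domain

end NodalOperators

theorem propositionC1 (L a : ℝ) (hL : 0 < L) (ha : 0 < a) (hLa : ∃ M : ℕ, L = M * a) :
    -- the density and spin operators are well defined, with common invariant core
    (Dense (finiteExcitations L a : Set (NodalFock L a)) ∧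
      diracVacuum L a ∈ finiteExcitations L a ∧
      (∀ (μ : Fin 4) (r s : ℤˣ), ∀ p ∈ bosonMomenta L,
        finiteExcitations L a ≤ (bilinearSeries L a μ r s p).domain ∧
        (bilinearSeries L a μ r s p).IsClosable ∧
        (nodalCurrent L a μ r s p).HasCore (finiteExcitations L a)) ∧
      (∀ (r s : ℤˣ), ∀ p ∈ bosonMomenta L, ∀ φ ∈ finiteExcitations L a,
        φ ∈ (nodalDensity L a r s p).domain ∧
        act (nodalDensity L a r s p) φ ∈ finiteExcitations L a ∧
        ∀ i : Fin 3, φ ∈ (nodalSpin L a i r s p).domain ∧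
          act (nodalSpin L a i r s p) φ ∈ finiteExcitations L a)) ∧
    -- commutation relations
    (∀ p ∈ bosonMomenta L, ∀ p' ∈ bosonMomenta L, ∀ φ ∈ finiteExcitations L a,
      (∀ r s : ℤˣ,
        commAt (nodalDensity L a r s p) (nodalDensity L a r s p') φ =
          ((((r : ℤ) : ℝ) * (4 * Real.pi * p s / a) * (L / (2 * Real.pi)) ^ 2 : ℝ) : ℂ) •
            umklappDelta a s (p + p') • φ) ∧
      (∀ (r s : ℤˣ) (i j : Fin 3),
        commAt (nodalSpin L a i r s p) (nodalSpin L a j r s p') φ =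
          (Complex.I • ∑ k : Fin 3, leviCivita i j k • act (nodalSpin L a k r s (p + p')) φ) +
          (if i = j then (1 : ℂ) else 0) •
            ((((r : ℤ) : ℝ) * (Real.pi * p s / a) * (L / (2 * Real.pi)) ^ 2 : ℝ) : ℂ) •
              umklappDelta a s (p + p') • φ) ∧
      (∀ (r s r' s' : ℤˣ) (i : Fin 3),
        commAt (nodalDensity L a r s p) (nodalSpin L a i r' s' p') φ = 0) ∧
      (∀ r s r' s' : ℤˣ, (r, s) ≠ (r', s') →
        commAt (nodalDensity L a r s p) (nodalDensity L a r' s' p') φ = 0 ∧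
        ∀ i j : Fin 3, commAt (nodalSpin L a i r s p) (nodalSpin L a j r' s' p') φ = 0)) ∧
    -- adjoints
    (∀ (r s : ℤˣ), ∀ p ∈ bosonMomenta L,
      (nodalDensity L a r s p).adjoint = nodalDensity L a r s (-p) ∧
      ∀ i : Fin 3, (nodalSpin L a i r s p).adjoint = nodalSpin L a i r s (-p)) ∧
    -- highest weight condition
    (∀ (r s : ℤˣ), ∀ p ∈ bosonMomenta L, 0 ≤ ((r : ℤ) : ℝ) * p s →
      act (nodalDensity L a r s p) (diracVacuum L a) = 0 ∧
      ∀ i : Fin 3, act (nodalSpin L a i r s p) (diracVacuum L a) = 0) := by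
  obtain ⟨M, hM⟩ := hLa
  have hM0 : 0 < M := Nat.pos_of_ne_zero fun h => hL.ne' (by rw [hM, h, Nat.cast_zero, zero_mul])
  exact ⟨⟨dense_span_occVec, diracVacuum_mem_finiteExcitations,
      fun μ r s p _ => ⟨finiteExcitations_le_domain_bilinearSeries ha hM0 hM μ r s p,
        isClosable_bilinearSeries ha hM0 hM μ r s p, hasCore_nodalCurrent ha hM0 hM μ r s p⟩,
      fun r s p _ _ hφ => ⟨(hasCore_nodalCurrent ha hM0 hM 0 r s p).le_domain hφ,
        act_nodalDensity_mem ha hM0 hM r s p hφ,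
        fun i => ⟨(hasCore_nodalCurrent ha hM0 hM i.succ r s p).le_domain hφ,
          act_nodalSpin_mem ha hM0 hM i r s p hφ⟩⟩⟩,
    fun p hp p' hp' φ hφ => ⟨fun r s => commAt_nodalDensity ha hM0 hM r s hp hp' hφ,
      fun r s i j => commAt_nodalSpin ha hM0 hM r s i j hp hp' hφ,
      fun r s r' s' i => commAt_nodalDensity_nodalSpin ha hM0 hM r s r' s' i hp hp' hφ,
      fun _ _ _ _ h => ⟨commAt_nodalDensity_of_ne ha hM0 hM h p p' hφ,
        fun i j => commAt_nodalSpin_of_ne ha hM0 hM h i j p p' hφ⟩⟩,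
    fun r s p _ => ⟨adjoint_nodalCurrent ha hM0 hM 0 r s p,
      fun i => adjoint_nodalSpin ha hM0 hM i r s p⟩,
    fun r s p _ h => ⟨act_nodalDensity_vacuum ha hM0 hM h,
      fun i => act_nodalSpin_vacuum ha hM0 hM i h⟩⟩
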